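/- Let $\mathcal{R}\subset\mathbb{R}$ be the set of all real numbers that have a base $3$ expansion containing only finitely many digits $1$, let $s=\log_3 2$, let $\mathcal{H}^s$ be the $s$-dimensional Hausdorff measure on $\mathcal{R}$, and let $\mathbf{C}\subset\mathcal{R}$ be the triadic Cantor set. On the complex Hilbert space $L^2(\mathcal{R},\mathcal{H}^s)$ define $$T_\lambda f(x)=f(x-\lambda)\quad(\lambda\in\mathbb{Z}[1/3]),\qquad Uf(x)=\frac{1}{\sqrt2}\,f\!\left(\frac{x}{3}\right).$$ Let $$\mathcal{S}_3=\{(z_n)_{n\in\mathbb{Z}}\in\mathbb{C}^{\mathbb{Z}} : z_{n+1}^3=z_n,\ |z_n|=1\ \text{for all } n\in\mathbb{Z}\}$$ with its product Borel structure, let $S(z_n)_{n}=(z_{n-1})_{n}$, let $\chi_\lambda((z_n)_n)=z_p^k$ for $\lambda=k/3^p\in\mathbb{Z}[1/3]$ ($k\in\mathbb{Z}$, $p\ge 0$), and let $m_0((z_n)_n)=(1+z_0^2)/\sqrt2$. There is a unique Borel probability measure $m$ on $\mathcal{S}_3$ such that, for all $\lambda\in\mathbb{Z}[1/3]$, $$\int_{\mathcal{S}_3}\chi_\lambda\,dm=\begin{cases}2^{-(|d_1|+\dots+|d_n|)/2},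 & \text{if } \lambda=\sum_{i=1}^{n} d_i/3^i \text{ for some } n\ge 0 \text{ and } d_i\in\{-2,0,2\},\\ 0, & \text{if } \lambda \text{ is not of this form.}\end{cases}$$ For this measure $m$ there is a unique unitary isomorphism $\mathcal{F}_3$ from $L^2(\mathcal{R},\mathcal{H}^s)$ onto $L^2(\mathcal{S}_3,m)$ such that, for all $f\in L^2(\mathcal{S}_3,m)$, $$\mathcal{F}_3T_\lambda\mathcal{F}_3^{-1}f=\chi_\lambda f\quad(\lambda\in\mathbb{Z}[1/3]),$$ $$\mathcal{F}_3U\mathcal{F}_3^{-1}f=m_0\cdot(f\circ S),$$ $$\mathcal{F}_3\chi_{\mathbf{C}}=1.$$ -/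

import Mathlib

open MeasureTheory MeasureTheory.Measure Set Filter
open scoped ENNReal NNReal Topology Pointwise

namespace FractalFourier

/-! ### The real numbers having a base 3 expansion with finitely many digits `1` -/

/-- The set of all real numbers that have a base 3 expansion containing only finitely many `1`s.
A base 3 expansion of `x` is `|x| = 3 ^ N * 0.d₀d₁d₂…` (that is, `N` digits before the point). -/
def finOnes : Set ℝ :=
  {x | ∃ (N : ℕ) (d : ℕ → Fin 3), {n | d n = 1}.Finite ∧ |x| = 3 ^ N * Real.ofDigits d}

theorem ofDigits_cons (d : ℕ → Fin 3) (a : Fin 3) :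
    Real.ofDigits (fun n => Nat.casesOn n a d : ℕ → Fin 3) = ((a : ℕ) + Real.ofDigits d) / 3 := by
  rw [Real.ofDigits_eq_sum_add_ofDigits _ 1]
  simp [Real.ofDigitsTerm]
  ring

theorem finite_ones_cons {d : ℕ → Fin 3} (hd : {n | d n = 1}.Finite) (a : Fin 3) :
    {n | (Nat.casesOn n a d : Fin 3) = 1}.Finite := by
  refine ((hd.image Nat.succ).union (finite_singleton 0)).subset ?_
  rintro (_ | n) hn
  · exact Or.inr rfl
  · exact Or.inl ⟨n, hn, rfl⟩

/-- Any natural number plus a fractional part with finitely many digits `1`. -/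
theorem nat_add_ofDigits (j : ℕ) : ∀ d : ℕ → Fin 3, {n | d n = 1}.Finite →
    ∃ (N : ℕ) (d' : ℕ → Fin 3), {n | d' n = 1}.Finite ∧
      (j : ℝ) + Real.ofDigits d = 3 ^ N * Real.ofDigits d' := by
  induction j using Nat.strong_induction_on with
  | _ j ih =>
    intro d hd
    rcases Nat.eq_zero_or_pos j with rfl | hj
    · exact ⟨0, d, hd, by simp⟩
    · obtain ⟨N, d', hd', h⟩ := ih (j / 3) (by omega) _
        (finite_ones_cons hd ⟨j % 3, Nat.mod_lt _ (by norm_num)⟩)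
      refine ⟨N + 1, d', hd', ?_⟩
      rw [ofDigits_cons] at h
      have hj' : (j : ℝ) = 3 * ((j / 3 : ℕ) : ℝ) + ((j % 3 : ℕ) : ℝ) := by
        exact_mod_cast (Nat.div_add_mod j 3).symm
      rw [pow_succ, mul_right_comm, ← h, hj']
      simp only
      ring

theorem div_three_mem {x : ℝ} (hx : x ∈ finOnes) : x / 3 ∈ finOnes := by
  obtain ⟨N, d, hd, h⟩ := hx
  refine ⟨N, _, finite_ones_cons hd 0, ?_⟩
  rw [ofDigits_cons, abs_div, h]
  norm_num
  ring

theorem three_mul_mem {x : ℝ} (hx : x ∈ finOnes) : 3 * x ∈ finOnes := by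
  obtain ⟨N, d, hd, h⟩ := hx
  exact ⟨N + 1, d, hd, by rw [abs_mul, h, pow_succ]; norm_num; ring⟩

theorem neg_mem {x : ℝ} (hx : x ∈ finOnes) : -x ∈ finOnes := by
  simpa [finOnes] using hx

theorem three_pow_mul_mem_iff {x : ℝ} (n : ℕ) : 3 ^ n * x ∈ finOnes ↔ x ∈ finOnes := by
  induction n with
  | zero => simp
  | succ n ih =>
    rw [← ih]
    refine ⟨fun h => ?_, fun h => ?_⟩
    · have := div_three_mem h
      rwa [show (3 : ℝ) ^ (n + 1) * x / 3 = 3 ^ n * x by ring] at this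
    · have := three_mul_mem h
      rwa [show (3 : ℝ) * (3 ^ n * x) = 3 ^ (n + 1) * x by ring] at this

theorem one_sub_mem_cantorSet {c : ℝ} (hc : c ∈ cantorSet) : 1 - c ∈ cantorSet := by
  simp only [cantorSet, mem_iInter] at hc ⊢
  intro n
  have key : ∀ (n : ℕ) (c : ℝ), c ∈ preCantorSet n → 1 - c ∈ preCantorSet n := by
    intro n
    induction n with
    | zero => intro c hc; simp at hc ⊢; constructor <;> linarith [hc.1, hc.2]
    | succ n ih =>
      rintro c (⟨y, hy, rfl⟩ | ⟨y, hy, rfl⟩)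
      · exact Or.inr ⟨1 - y, ih y hy, by ring⟩
      · exact Or.inl ⟨1 - y, ih y hy, by ring⟩
  exact key n c (hc n)

theorem int_add_mem (k : ℤ) {c : ℝ} (hc : c ∈ cantorSet) : (k : ℝ) + c ∈ finOnes := by
  have nat_case : ∀ (j : ℕ) {c : ℝ}, c ∈ cantorSet → (j : ℝ) + c ∈ finOnes := by
    intro j c hc
    have h0 := (cantorSet_subset_unitInterval hc).1
    rw [cantorSet_eq_zero_two_ofDigits] at hc
    obtain ⟨a, ha, rfl⟩ := hc
    obtain ⟨N, d, hd, h⟩ := nat_add_ofDigits j a (by simp [ha])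
    exact ⟨N, d, hd, by rw [abs_of_nonneg (by positivity), h]⟩
  rcases k with j | j
  · simpa using nat_case j hc
  · have := neg_mem (nat_case j (one_sub_mem_cantorSet hc))
    convert this using 1
    push_cast
    ring

theorem exists_int_add {x : ℝ} (hx : x ∈ finOnes) :
    ∃ n₀ : ℕ, ∀ n ≥ n₀, ∃ (k : ℤ) (c : ℝ), c ∈ cantorSet ∧ 3 ^ n * x = k + c := by
  obtain ⟨N, d, hd, h⟩ := hx
  obtain ⟨M, hM⟩ := hd.bddAbove
  -- the digits from position `M + 1` on avoid `1`
  have hint : ∀ n : ℕ, ∃ j : ℤ, (3 : ℝ) ^ n * ∑ i ∈ Finset.range n, Real.ofDigitsTerm d i = j := by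
    intro n
    induction n with
    | zero => exact ⟨0, by simp⟩
    | succ n ih =>
      obtain ⟨j, hj⟩ := ih
      refine ⟨3 * j + (d n : ℕ), ?_⟩
      rw [Finset.sum_range_succ, mul_add, pow_succ, mul_right_comm, hj, Real.ofDigitsTerm]
      push_cast
      field_simp
      ring
  have habs : ∀ n ≥ M + 1, ∃ (k : ℤ) (c : ℝ), c ∈ cantorSet ∧ 3 ^ n * |x| = k + c := by
    intro n hn
    obtain ⟨j, hj⟩ := hint (n + N)
    refine ⟨j, Real.ofDigits (fun i => d (i + (n + N))), ?_, ?_⟩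
    · refine ofDigits_zero_two_sequence_mem_cantorSet fun i hi => ?_
      have := hM hi
      omega
    · rw [h, Real.ofDigits_eq_sum_add_ofDigits d (n + N), ← hj]
      push_cast
      rw [← mul_assoc, ← pow_add, mul_add, mul_inv_cancel_left₀ (by positivity)]
  refine ⟨M + 1, fun n hn => ?_⟩
  obtain ⟨k, c, hc, hk⟩ := habs n hn
  rcases abs_choice x with hx | hx
  · exact ⟨k, c, hc, by rw [← hk, hx]⟩
  · refine ⟨-k - 1, 1 - c, one_sub_mem_cantorSet hc, ?_⟩
    rw [hx] at hk
    push_cast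
    linarith

theorem sub_triadic_mem {x : ℝ} (hx : x ∈ finOnes) (k : ℤ) (p : ℕ) :
    x - k / 3 ^ p ∈ finOnes := by
  obtain ⟨n₀, h⟩ := exists_int_add hx
  obtain ⟨j, c, hc, hj⟩ := h (n₀ + p) (by omega)
  rw [← three_pow_mul_mem_iff (n₀ + p)]
  have : (3 : ℝ) ^ (n₀ + p) * (x - k / 3 ^ p) = ((j - 3 ^ n₀ * k : ℤ) : ℝ) + c := by
    rw [mul_sub, hj, pow_add]
    push_cast
    field_simp
    ring
  rw [this]
  exact int_add_mem _ hc

theorem preimage_sub_triadic (k : ℤ) (p : ℕ) :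
    (fun x : ℝ => x - k / 3 ^ p) ⁻¹' finOnes = finOnes := by
  ext x
  refine ⟨fun h => ?_, fun h => sub_triadic_mem h k p⟩
  have := sub_triadic_mem h (-k) p
  push_cast at this
  rwa [show x - (k : ℝ) / 3 ^ p - -(k : ℝ) / 3 ^ p = x by ring] at this

theorem preimage_div_three : (fun x : ℝ => x / 3) ⁻¹' finOnes = finOnes := by
  ext x
  refine ⟨fun h => ?_, div_three_mem⟩
  have := three_mul_mem h
  rwa [mul_div_cancel₀ x (by norm_num : (3 : ℝ) ≠ 0)] at this

/-! ### The Hausdorff measure and the operators on `L²` -/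

/-- The dimension `s = log 2 / log 3` of the triadic Cantor set. -/
noncomputable def cantorDim : ℝ := Real.logb 3 2

theorem cantorDim_nonneg : 0 ≤ cantorDim := Real.logb_nonneg (by norm_num) (by norm_num)

theorem three_rpow_cantorDim : (3 : ℝ≥0∞) ^ cantorDim = 2 := by
  have h : (3 : ℝ) ^ cantorDim = 2 := Real.rpow_logb (by norm_num) (by norm_num) (by norm_num)
  have := ENNReal.ofReal_rpow_of_nonneg (x := 3) (by norm_num) cantorDim_nonneg
  rw [h] at this
  simpa using this

/-- The `s`-dimensional Hausdorff measure on the set `finOnes`. -/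
noncomputable def fractalMeasure : Measure ℝ := (μH[cantorDim] : Measure ℝ).restrict finOnes

/-- The Hilbert space `L²(ℛ, ℋˢ)`. -/
noncomputable abbrev FractalL2 : Type := Lp ℂ 2 fractalMeasure

theorem measurePreserving_sub (k : ℤ) (p : ℕ) :
    MeasurePreserving (fun x : ℝ => x - k / 3 ^ p) fractalMeasure fractalMeasure := by
  have h := ((IsometryEquiv.subRight ((k : ℝ) / 3 ^ p)).measurePreserving_hausdorffMeasure
    cantorDim).restrict_preimage_emb
    (IsometryEquiv.subRight ((k : ℝ) / 3 ^ p)).toHomeomorph.measurableEmbedding finOnes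
  have e : ⇑(IsometryEquiv.subRight ((k : ℝ) / 3 ^ p)) = fun x : ℝ => x - k / 3 ^ p := rfl
  rw [e, preimage_sub_triadic] at h
  exact h

theorem measurePreserving_div :
    MeasurePreserving (fun x : ℝ => x / 3) fractalMeasure ((2 : ℝ≥0∞) • fractalMeasure) := by
  have h : MeasurePreserving (fun x : ℝ => x / 3) (μH[cantorDim] : Measure ℝ)
      ((2 : ℝ≥0∞) • (μH[cantorDim] : Measure ℝ)) := by
    refine ⟨by fun_prop, ?_⟩
    ext A hA
    rw [Measure.map_apply (by fun_prop) hA]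
    have e : (fun x : ℝ => x / 3) ⁻¹' A = (3 : ℝ) • A := by
      ext x
      rw [mem_smul_set_iff_inv_smul_mem₀ (by norm_num)]
      simp [div_eq_inv_mul]
    rw [e, hausdorffMeasure_smul₀ cantorDim_nonneg (by norm_num)]
    simp only [Measure.smul_apply, smul_eq_mul, ENNReal.smul_def]
    rw [ENNReal.coe_rpow_of_nonneg _ cantorDim_nonneg,
      show ((‖(3 : ℝ)‖₊ : ℝ≥0) : ℝ≥0∞) = 3 by simp, three_rpow_cantorDim]
  have h' := h.restrict_preimage_emb
    (Homeomorph.mulRight₀ (3⁻¹ : ℝ) (by norm_num)).measurableEmbedding finOnes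
  rw [preimage_div_three, Measure.restrict_smul] at h'
  exact h'

theorem memLp_translation (k : ℤ) (p : ℕ) (f : FractalL2) :
    MemLp (fun x : ℝ => f (x - k / 3 ^ p)) 2 fractalMeasure :=
  (Lp.memLp f).comp_measurePreserving (measurePreserving_sub k p)

theorem memLp_dilation (f : FractalL2) :
    MemLp (fun x : ℝ => ((1 / √2 : ℝ) : ℂ) * f (x / 3)) 2 fractalMeasure :=
  (((Lp.memLp f).smul_measure (by simp : (2 : ℝ≥0∞) ≠ ∞)).comp_measurePreserving
    measurePreserving_div).const_mul _

/-- `T_λ f (x) = f (x - λ)` for `λ = k / 3 ^ p`. -/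
noncomputable def translation (k : ℤ) (p : ℕ) (f : FractalL2) : FractalL2 :=
  (memLp_translation k p f).toLp _

/-- `U f (x) = (1 / √2) f (x / 3)`. -/
noncomputable def dilation (f : FractalL2) : FractalL2 := (memLp_dilation f).toLp _

theorem fractalMeasure_cantorSet_ne_top : fractalMeasure cantorSet ≠ ∞ := by
  refine ne_top_of_le_ne_top ENNReal.one_ne_top ((Measure.restrict_apply_le _ _).trans ?_)
  let w : (n : ℕ) → (Fin n → Bool) → ℕ → Fin 3 := fun n b i =>
    if h : i < n then cond (b ⟨i, h⟩) 2 0 else 0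
  let a : (n : ℕ) → (Fin n → Bool) → ℝ := fun n b =>
    ∑ i ∈ Finset.range n, Real.ofDigitsTerm (w n b) i
  let t : (n : ℕ) → (Fin n → Bool) → Set ℝ := fun n b => Icc (a n b) (a n b + 3⁻¹ ^ n)
  have hd : ∀ n b, Metric.ediam (t n b) = (3⁻¹ : ℝ≥0∞) ^ n := by
    intro n b
    simp only [t, Real.ediam_Icc, add_sub_cancel_left]
    rw [ENNReal.ofReal_pow (by norm_num), ENNReal.ofReal_inv_of_pos (by norm_num)]
    simp
  refine (hausdorffMeasure_le_liminf_sum (l := atTop) cantorDim cantorSet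
    (fun n : ℕ => (3⁻¹ : ℝ≥0∞) ^ n) ?_ t ?_ ?_).trans ?_
  · exact ENNReal.tendsto_pow_atTop_nhds_zero_of_lt_one (ENNReal.inv_lt_one.2 (by norm_num))
  · exact Eventually.of_forall fun n b => (hd n b).le
  · refine Eventually.of_forall fun n x hx => mem_iUnion.2 ⟨fun i => (cantorToBinary x).get i, ?_⟩
    have e : a n (fun i => (cantorToBinary x).get i) =
        ∑ i ∈ Finset.range n, Real.ofDigitsTerm (cantorToTernary x) i := by
      refine Finset.sum_congr rfl fun i hi => ?_
      have hi' := Finset.mem_range.1 hi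
      have e' : w n (fun i => (cantorToBinary x).get i) i = (cantorToTernary x) i := by
        simp only [w, dif_pos hi']
        rfl
      simp only [Real.ofDigitsTerm, e']
    simp only [t, mem_Icc, e]
    exact ⟨ofDigits_cantorToTernary_sum_le hx, by
      linarith [le_ofDigits_cantorToTernary_sum hx (n := n)]⟩
  · simp only [hd]
    have e : ∀ n : ℕ, ((3⁻¹ : ℝ≥0∞) ^ n) ^ cantorDim = 2⁻¹ ^ n := by
      intro n
      rw [← ENNReal.rpow_natCast, ← ENNReal.rpow_mul, mul_comm, ENNReal.rpow_mul,
        ENNReal.inv_rpow, three_rpow_cantorDim, ENNReal.rpow_natCast]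
    simp only [e, Finset.sum_const, Finset.card_univ, Fintype.card_fun, Fintype.card_bool,
      Fintype.card_fin, nsmul_eq_mul]
    push_cast
    simp only [← mul_pow, ENNReal.mul_inv_cancel (by norm_num : (2 : ℝ≥0∞) ≠ 0) (by norm_num),
      one_pow, liminf_const, le_refl]

/-- The indicator function of the triadic Cantor set, as an element of `L²(ℛ, ℋˢ)`. -/
noncomputable def cantorIndicator : FractalL2 :=
  indicatorConstLp 2 isClosed_cantorSet.measurableSet fractalMeasure_cantorSet_ne_top 1

/-! ### The solenoid -/

/-- The solenoid `{(zₙ)ₙ | zₙ₊₁ ^ N = zₙ, |zₙ| = 1, n ∈ ℤ}`. -/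
abbrev Solenoid (N : ℕ) : Type :=
  {z : ℤ → ℂ // ∀ n, z (n + 1) ^ N = z n ∧ ‖z n‖ = 1}

/-- The shift `S (zₙ)ₙ = (zₙ₋₁)ₙ`. -/
def Solenoid.shift {N : ℕ} (z : Solenoid N) : Solenoid N :=
  ⟨fun n => z.1 (n - 1), fun n => by
    have h := z.2 (n - 1)
    rw [sub_add_cancel] at h
    simpa only [add_sub_cancel_right] using h⟩

/-- The character `χ_λ` for `λ = k / N ^ p`, given by `χ_λ (zₙ)ₙ = z_p ^ k`. -/
noncomputable def character {N : ℕ} (k : ℤ) (p : ℕ) (z : Solenoid N) : ℂ := z.1 p ^ k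

theorem Solenoid.pow_eq {N : ℕ} (z : Solenoid N) (p q : ℕ) :
    z.1 ((p + q : ℕ) : ℤ) ^ N ^ q = z.1 p := by
  induction q with
  | zero => simp
  | succ q ih =>
    rw [pow_succ', pow_mul, ← ih]
    congr 1
    exact_mod_cast (z.2 ((p + q : ℕ) : ℤ)).1

/-- The character depends only on the number `k / N ^ p`. -/
theorem character_congr {N : ℕ} (hN : N ≠ 0) {k k' : ℤ} {p p' : ℕ}
    (h : (k : ℝ) / N ^ p = k' / N ^ p') (z : Solenoid N) :
    character k p z = character k' p' z := by
  have hN' : (N : ℝ) ≠ 0 := by exact_mod_cast hN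
  have h' : (N : ℤ) ^ p' * k = (N : ℤ) ^ p * k' := by
    rw [div_eq_div_iff (by positivity) (by positivity)] at h
    have : (N : ℝ) ^ p' * k = (N : ℝ) ^ p * k' := by linarith
    exact_mod_cast this
  simp only [character]
  rw [← z.pow_eq p p', ← z.pow_eq p' p, add_comm p' p, ← zpow_natCast, ← zpow_natCast (_ : ℂ) (N ^ p),
    ← zpow_mul, ← zpow_mul]
  push_cast
  rw [h']

/-- The filter `m₀(z) = (1 + z²) / √2`. -/
noncomputable def lowPass (z : ℂ) : ℂ := (1 + z ^ 2) / (√2 : ℝ)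

/-- `x = ∑_{i=1}^{n} dᵢ / 3ⁱ` with all `dᵢ ∈ {-2, 0, 2}`. -/
def IsDigitSum (x : ℝ) (n : ℕ) (d : ℕ → ℤ) : Prop :=
  (∀ i ∈ Finset.Icc 1 n, d i ∈ ({-2, 0, 2} : Set ℤ)) ∧ x = ∑ i ∈ Finset.Icc 1 n, (d i : ℝ) / 3 ^ i

/-- The Fourier coefficients `∫ χ_λ dm`, `λ = k / 3 ^ p`, are `2 ^ (-(|d₁| + … + |dₙ|) / 2)`
if `λ = ∑_{i=1}^{n} dᵢ / 3ⁱ` with `dᵢ ∈ {-2, 0, 2}`, and `0` if `λ` is not of this form. -/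
def HasCantorCoefficients (m : Measure (Solenoid 3)) : Prop :=
  ∀ (k : ℤ) (p : ℕ),
    (∀ (n : ℕ) (d : ℕ → ℤ), IsDigitSum ((k : ℝ) / 3 ^ p) n d →
      ∫ z, character k p z ∂m
        = (((2 : ℝ) ^ (-(∑ i ∈ Finset.Icc 1 n, |(d i : ℝ)|) / 2) : ℝ) : ℂ)) ∧
    ((¬ ∃ (n : ℕ) (d : ℕ → ℤ), IsDigitSum ((k : ℝ) / 3 ^ p) n d) →
      ∫ z, character k p z ∂m = 0)

end FractalFourier

/-! Each L² space is generated by one vector: the translates T_λ χ_C are total in L²(ℛ, ℋˢ), and the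
characters χ_λ are total in L²(m). Two total families with the same Gram matrix are related by a
unitary, so `exists_fourierTransform` only needs ⟨T_λ χ_C, χ_C⟩ = ∫ χ_λ dm. The intertwining
relations are then checked on the total family, and uniqueness holds because the relations fix the
images of all T_λ χ_C.

Coefficients. Write c(λ) for the correlation ⟨T_λ χ_C, χ_C⟩. The refinement equation U χ_C = (χ_C +
T_2 χ_C)/√2 gives c(λ) = c(3λ) + c(3λ+2)/2 + c(3λ-2)/2. On integers c is the Kronecker delta, since
ℋˢ(C) = 1: the natural covers bound it above, and the s-Hölder Cantor function bounds it below.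
`coef` is the solution of this recursion, and reading it digit by digit gives the prescribed powers
of 2.

The measure. The Riesz products ∏ (1 + cos(4πt/3ⁱ)), wound around the solenoid, satisfy the same
recursion, so each of their Fourier coefficients is eventually equal to `coef`, and a weak cluster
point has the required coefficients. Uniqueness is Stone–Weierstrass. The recursion also says that S
carries |m₀|² dm to m (`map_shift_lowPassMeasure`), which makes f ↦ m₀·(f∘S) isometric.

Totality of the translates (`eq_zero_of_inner_translation_eq_zero`). Let f be orthogonal to all of
them. A copy of C is two smaller copies, so along an arithmetic progression of disjoint small copies
the integral of f only changes sign; Bessel's inequality forces it to be 0. Thus f integrates to 0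
over every triadic copy of C at every scale, hence over the Borel subsets of such a copy, and these
copies cover ℛ. -/

namespace FractalFourier

/-! ### The Fourier coefficients -/

/-- The correlation `ℋˢ (C ∩ (C + k / 3 ^ p))` of the Cantor set with its translate, given by its
recursion under scaling. -/
noncomputable def coef : ℕ → ℤ → ℝ
  | 0, k => if k = 0 then 1 else 0
  | p + 1, k => coef p k + 1 / 2 * coef p (k + 2 * 3 ^ p) + 1 / 2 * coef p (k - 2 * 3 ^ p)

theorem coef_succ (p : ℕ) (k : ℤ) :
    coef (p + 1) k = coef p k + 1 / 2 * coef p (k + 2 * 3 ^ p) + 1 / 2 * coef p (k - 2 * 3 ^ p) :=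
  rfl

/-- The defining recursion acts on the leading ternary digit, whereas this lemma and the next act on
the last one. The two operations commute, so induction on `p` reduces to the delta at `p = 0`, where
`3 * k ± 2` is never 0. -/
theorem coef_three_mul (p : ℕ) (k : ℤ) : coef (p + 1) (3 * k) = coef p k := by
  induction p generalizing k with
  | zero =>
    simp only [coef, pow_zero, mul_one]
    have h1 : 3 * k + 2 ≠ 0 := by omega
    have h2 : 3 * k - 2 ≠ 0 := by omega
    by_cases h : k = 0 <;> simp [h, h1, h2]
  | succ p ih =>
    rw [coef_succ (p + 1), ih, coef_succ p k,
      show 3 * k + 2 * 3 ^ (p + 1) = 3 * (k + 2 * 3 ^ p) by ring,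
      show 3 * k - 2 * 3 ^ (p + 1) = 3 * (k - 2 * 3 ^ p) by ring, ih, ih]

theorem coef_three_mul_add (p : ℕ) (k : ℤ) {d : ℤ} (hd : d = 2 ∨ d = -2) :
    coef (p + 1) (3 * k + d) = 1 / 2 * coef p k := by
  induction p generalizing k with
  | zero =>
    simp only [coef, pow_zero, mul_one]
    rcases hd with rfl | rfl
    · have h1 : 3 * k + 2 + 2 ≠ 0 := by omega
      have h2 : 3 * k + 2 ≠ 0 := by omega
      by_cases h : k = 0 <;> simp [h, h1, h2]
    · have h1 : 3 * k + -2 - 2 ≠ 0 := by omega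
      have h2 : 3 * k + -2 ≠ 0 := by omega
      by_cases h : k = 0 <;> simp [h, h1, h2]
  | succ p ih =>
    rw [coef_succ (p + 1), ih, coef_succ p k,
      show 3 * k + d + 2 * 3 ^ (p + 1) = 3 * (k + 2 * 3 ^ p) + d by ring,
      show 3 * k + d - 2 * 3 ^ (p + 1) = 3 * (k - 2 * 3 ^ p) + d by ring, ih, ih]
    ring

theorem coef_mul_three_pow (p q : ℕ) (k : ℤ) : coef (p + q) (3 ^ q * k) = coef p k := by
  induction q with
  | zero => simp
  | succ q ih => rw [pow_succ', mul_assoc, ← add_assoc, coef_three_mul, ih]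

/-- The correlation depends only on the number `k / 3 ^ p`. -/
theorem coef_congr {k k' : ℤ} {p p' : ℕ} (h : (k : ℝ) / 3 ^ p = k' / 3 ^ p') :
    coef p k = coef p' k' := by
  rw [← coef_mul_three_pow p p', ← coef_mul_three_pow p' p, add_comm p' p]
  congr 1
  rw [div_eq_div_iff (by positivity) (by positivity)] at h
  have : (3 : ℝ) ^ p' * k = 3 ^ p * k' := by linarith
  exact_mod_cast this

/-- Appending a last digit 0 changes nothing, and appending ±2 costs the factor 1/2 = 2^(-|±2|/2).
-/
theorem coef_of_digits (n : ℕ) (d : ℕ → ℤ) (hd : ∀ i ∈ Finset.Icc 1 n, d i ∈ ({-2, 0, 2} : Set ℤ)) :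
    ∃ k : ℤ, (k : ℝ) / 3 ^ n = ∑ i ∈ Finset.Icc 1 n, (d i : ℝ) / 3 ^ i ∧
      coef n k = (2 : ℝ) ^ (-(∑ i ∈ Finset.Icc 1 n, |(d i : ℝ)|) / 2) := by
  induction n with
  | zero => exact ⟨0, by simp, by simp [coef]⟩
  | succ n ih =>
    obtain ⟨k, hk, hc⟩ := ih fun i hi => hd i (by simp at hi ⊢; omega)
    refine ⟨3 * k + d (n + 1), ?_, ?_⟩
    · rw [Finset.sum_Icc_succ_top (by omega), ← hk]
      push_cast
      field_simp
      ring
    · rw [Finset.sum_Icc_succ_top (by omega), neg_add, add_div, Real.rpow_add (by norm_num), ← hc]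
      have h := hd (n + 1) (by simp)
      simp only [mem_insert_iff, mem_singleton_iff] at h
      rcases h with h | h | h
      · rw [h, coef_three_mul_add n k (Or.inr rfl)]
        norm_num [Real.rpow_neg_one]
        ring
      · rw [h, add_zero, coef_three_mul]
        simp
      · rw [h, coef_three_mul_add n k (Or.inl rfl)]
        norm_num [Real.rpow_neg_one]
        ring

theorem exists_isDigitSum_of_coef_ne_zero (p : ℕ) (k : ℤ) (h : coef p k ≠ 0) :
    ∃ d : ℕ → ℤ, IsDigitSum ((k : ℝ) / 3 ^ p) p d := by
  induction p generalizing k with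
  | zero =>
    have hk : k = 0 := by
      by_contra h'
      exact h (by simp [coef, h'])
    exact ⟨0, by simp, by simp [hk]⟩
  | succ p ih =>
    -- The digits 0, 2, -2 form a complete residue system mod 3, so the last digit can always be
    -- split off; a nonzero coefficient stays nonzero for `j`.
    obtain ⟨j, e, he, rfl⟩ : ∃ j e : ℤ, (e = 0 ∨ e = 2 ∨ e = -2) ∧ k = 3 * j + e := by
      have h3 : k % 3 = 0 ∨ k % 3 = 1 ∨ k % 3 = 2 := by omega
      rcases h3 with h3 | h3 | h3
      · exact ⟨k / 3, 0, by simp, by omega⟩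
      · exact ⟨k / 3 + 1, -2, by simp, by omega⟩
      · exact ⟨k / 3, 2, by simp, by omega⟩
    have hj : coef p j ≠ 0 := by
      rcases he with rfl | he
      · rwa [add_zero, coef_three_mul] at h
      · rw [coef_three_mul_add p j he] at h
        exact right_ne_zero_of_mul h
    obtain ⟨d, hd, hs⟩ := ih j hj
    have hcongr : ∀ i ∈ Finset.Icc 1 p, Function.update d (p + 1) e i = d i := by
      intro i hi
      have := (Finset.mem_Icc.1 hi).2
      exact Function.update_of_ne (by omega) _ _
    refine ⟨Function.update d (p + 1) e, ?_, ?_⟩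
    · intro i hi
      by_cases hip : i = p + 1
      · subst hip
        rw [Function.update_self]
        rcases he with rfl | rfl | rfl <;> simp
      · have hi' : i ∈ Finset.Icc 1 p := by simp at hi ⊢; omega
        rw [hcongr i hi']
        exact hd i hi'
    · rw [Finset.sum_Icc_succ_top (by omega), Function.update_self,
        Finset.sum_congr rfl fun i hi => by rw [hcongr i hi], ← hs]
      push_cast
      field_simp
      ring

/-- Replaces digit expansions by the recursive `coef`. Since `coef` depends only on the number k /
3^p, the length and choice of the expansion do not matter. -/
theorem hasCantorCoefficients_iff {m : Measure (Solenoid 3)} :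
    HasCantorCoefficients m ↔ ∀ (k : ℤ) (p : ℕ), ∫ z, character k p z ∂m = (coef p k : ℂ) := by
  constructor
  · intro h k p
    by_cases h0 : ∃ (n : ℕ) (d : ℕ → ℤ), IsDigitSum ((k : ℝ) / 3 ^ p) n d
    · obtain ⟨n, d, hd⟩ := h0
      obtain ⟨k', hk', hc⟩ := coef_of_digits n d hd.1
      rw [(h k p).1 n d hd, ← hc, coef_congr (hk'.trans hd.2.symm)]
    · rw [(h k p).2 h0]
      by_contra hc
      refine h0 ⟨p, exists_isDigitSum_of_coef_ne_zero p k fun h' => hc (by simp [h'])⟩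
  · refine fun h k p => ⟨fun n d hd => ?_, fun h0 => ?_⟩
    · obtain ⟨k', hk', hc⟩ := coef_of_digits n d hd.1
      rw [h, ← hc, coef_congr (hk'.trans hd.2.symm)]
    · rw [h]
      by_contra hc
      refine h0 ⟨p, exists_isDigitSum_of_coef_ne_zero p k fun h' => hc (by simp [h'])⟩

/-! ### The Hausdorff measure of the Cantor set -/

theorem cantorDim_pos : 0 < cantorDim := Real.logb_pos (by norm_num) (by norm_num)

theorem cantorDim_le_one : cantorDim ≤ 1 := by
  rw [cantorDim, Real.logb_le_iff_le_rpow (by norm_num) (by norm_num)]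
  norm_num

theorem three_rpow_cantorDim_real : (3 : ℝ) ^ cantorDim = 2 :=
  Real.rpow_logb (by norm_num) (by norm_num) (by norm_num)

/-- The point of the Cantor set with ternary digits `2 bᵢ`. -/
noncomputable def ternaryPoint (b : ℕ → Fin 2) : ℝ :=
  Real.ofDigits (fun i => if b i = 0 then (0 : Fin 3) else 2)

theorem ternaryPoint_nonneg (b : ℕ → Fin 2) : 0 ≤ ternaryPoint b := Real.ofDigits_nonneg _

theorem ternaryPoint_le_one (b : ℕ → Fin 2) : ternaryPoint b ≤ 1 := Real.ofDigits_le_one _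

theorem ternaryPoint_eq (b : ℕ → Fin 2) :
    ternaryPoint b = (2 * (b 0 : ℕ) + ternaryPoint fun i => b (i + 1)) / 3 := by
  rw [ternaryPoint, Real.ofDigits_eq_sum_add_ofDigits _ 1, ternaryPoint]
  have : b 0 = 0 ∨ b 0 = 1 := by omega
  rcases this with h | h <;> simp [Real.ofDigitsTerm, h] <;> ring

theorem ofDigits_two_eq (b : ℕ → Fin 2) :
    Real.ofDigits b = ((b 0 : ℕ) + Real.ofDigits fun i => b (i + 1)) / 2 := by
  rw [Real.ofDigits_eq_sum_add_ofDigits _ 1]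
  simp [Real.ofDigitsTerm]
  ring

/-- Polygonal approximations of the Cantor function, in terms of digit sequences. -/
noncomputable def cantorApprox : ℕ → (ℕ → Fin 2) → ℝ
  | 0, b => ternaryPoint b
  | n + 1, b => ((b 0 : ℕ) + cantorApprox n fun i => b (i + 1)) / 2

theorem abs_cantorApprox_sub_le (n : ℕ) (b : ℕ → Fin 2) :
    |cantorApprox n b - Real.ofDigits b| ≤ (1 / 2) ^ n := by
  induction n generalizing b with
  | zero =>
    rw [cantorApprox, pow_zero, abs_le]
    constructor <;> linarith [ternaryPoint_nonneg b, ternaryPoint_le_one b,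
      Real.ofDigits_nonneg b, Real.ofDigits_le_one b]
  | succ n ih =>
    rw [cantorApprox, ofDigits_two_eq, ← sub_div, add_sub_add_left_eq_sub, abs_div, abs_two,
      pow_succ]
    linarith [ih fun i => b (i + 1)]

theorem ternaryPoint_zero : ternaryPoint (fun _ => 0) = 0 := by
  have := ternaryPoint_eq fun _ => 0
  simp at this
  linarith

theorem ternaryPoint_one : ternaryPoint (fun _ => 1) = 1 := by
  have := ternaryPoint_eq fun _ => 1
  simp at this
  linarith

theorem cantorApprox_zero (n : ℕ) : cantorApprox n (fun _ => 0) = 0 := by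
  induction n with
  | zero => exact ternaryPoint_zero
  | succ n ih => simp [cantorApprox, ih]

theorem cantorApprox_one (n : ℕ) : cantorApprox n (fun _ => 1) = 1 := by
  induction n with
  | zero => exact ternaryPoint_one
  | succ n ih => simp [cantorApprox, ih]

theorem half_rpow_cantorDim {x : ℝ} (hx : 0 ≤ x) :
    x ^ cantorDim / 2 = (x / 3) ^ cantorDim := by
  rw [Real.div_rpow hx (by norm_num), three_rpow_cantorDim_real]

/-- Concavity of x ↦ xˢ, followed by (u + v)/2 ≤ (u + v + 1)/3, which is u + v ≤ 2. The extra 1 is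
the removed middle third. -/
theorem rpow_add_rpow_cantorDim_le {u v : ℝ} (hu : 0 ≤ u) (hu' : u ≤ 1) (hv : 0 ≤ v) (hv' : v ≤ 1) :
    (u ^ cantorDim + v ^ cantorDim) / 2 ≤ ((u + v + 1) / 3) ^ cantorDim := by
  have h := (Real.concaveOn_rpow cantorDim_nonneg cantorDim_le_one).2 (mem_Ici.2 hu)
    (mem_Ici.2 hv) (by norm_num : (0 : ℝ) ≤ 1 / 2) (by norm_num : (0 : ℝ) ≤ 1 / 2) (by norm_num)
  simp only [smul_eq_mul] at h
  calc (u ^ cantorDim + v ^ cantorDim) / 2 ≤ (1 / 2 * u + 1 / 2 * v) ^ cantorDim := by linarith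
    _ ≤ _ := Real.rpow_le_rpow (by positivity) (by linarith) cantorDim_nonneg

/-- The Hölder bound with constant 1 survives each refinement. With equal first digits it rescales,
because 3ˢ = 2; with different first digits the two points lie on either side of the middle gap and
concavity applies. -/
theorem cantorApprox_sub_le (n : ℕ) (b b' : ℕ → Fin 2) (h : ternaryPoint b' ≤ ternaryPoint b) :
    cantorApprox n b - cantorApprox n b' ≤ (ternaryPoint b - ternaryPoint b') ^ cantorDim := by
  induction n generalizing b b' with
  | zero =>
    simp only [cantorApprox]
    have h0 : 0 ≤ ternaryPoint b - ternaryPoint b' := by linarith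
    have h1 : ternaryPoint b - ternaryPoint b' ≤ 1 := by
      linarith [ternaryPoint_le_one b, ternaryPoint_nonneg b']
    exact Real.self_le_rpow_of_le_one h0 h1 cantorDim_le_one
  | succ n ih =>
    simp only [cantorApprox]
    rw [ternaryPoint_eq b, ternaryPoint_eq b'] at h ⊢
    set c : ℕ → Fin 2 := fun i => b (i + 1)
    set c' : ℕ → Fin 2 := fun i => b' (i + 1)
    have hc0 := ternaryPoint_nonneg c
    have hc1 := ternaryPoint_le_one c
    have hc0' := ternaryPoint_nonneg c'
    have hc1' := ternaryPoint_le_one c'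
    have hb : b 0 = 0 ∨ b 0 = 1 := by omega
    have hb' : b' 0 = 0 ∨ b' 0 = 1 := by omega
    by_cases e : b 0 = b' 0
    · rw [e] at h ⊢
      have hcc : ternaryPoint c' ≤ ternaryPoint c := by linarith
      have := ih c c' hcc
      rw [show (2 * ((b' 0 : ℕ) : ℝ) + ternaryPoint c) / 3 - (2 * ((b' 0 : ℕ) : ℝ) +
        ternaryPoint c') / 3 = (ternaryPoint c - ternaryPoint c') / 3 by ring,
        ← half_rpow_cantorDim (by linarith)]
      linarith
    · rcases hb with hb | hb <;> rcases hb' with hb' | hb' <;>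
        first
        | exact absurd (hb.trans hb'.symm) e
        | rw [hb, hb'] at h ⊢
      · norm_num at h ⊢
        linarith
      · norm_num at h ⊢
        -- The increment is split at the two ends of the gap: from the left end of the right third
        -- up to `b`, and from `b'` up to the right end of the left third.
        have h1 := ih c (fun _ => 0) (by rw [ternaryPoint_zero]; exact hc0)
        have h2 := ih (fun _ => 1) c' (by rw [ternaryPoint_one]; exact hc1')
        rw [cantorApprox_zero, ternaryPoint_zero, sub_zero, sub_zero] at h1
        rw [cantorApprox_one, ternaryPoint_one] at h2
        have h3 := rpow_add_rpow_cantorDim_le hc0 hc1 (by linarith : 0 ≤ 1 - ternaryPoint c')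
          (by linarith)
        rw [show (2 + ternaryPoint c) / 3 - ternaryPoint c' / 3 =
          (ternaryPoint c + (1 - ternaryPoint c') + 1) / 3 by ring]
        linarith

theorem cantorApprox_mono (n : ℕ) (b b' : ℕ → Fin 2) (h : ternaryPoint b' ≤ ternaryPoint b) :
    cantorApprox n b' ≤ cantorApprox n b := by
  induction n generalizing b b' with
  | zero => exact h
  | succ n ih =>
    simp only [cantorApprox]
    rw [ternaryPoint_eq b, ternaryPoint_eq b'] at h
    set c : ℕ → Fin 2 := fun i => b (i + 1)
    set c' : ℕ → Fin 2 := fun i => b' (i + 1)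
    have hc0 := ternaryPoint_nonneg c
    have hc1' := ternaryPoint_le_one c'
    have hb : b 0 = 0 ∨ b 0 = 1 := by omega
    have hb' : b' 0 = 0 ∨ b' 0 = 1 := by omega
    by_cases e : b 0 = b' 0
    · rw [e] at h ⊢
      linarith [ih c c' (by linarith)]
    · have h1 := ih c (fun _ => 0) (by rw [ternaryPoint_zero]; exact hc0)
      have h2 := ih (fun _ => 1) c' (by rw [ternaryPoint_one]; exact hc1')
      rw [cantorApprox_zero] at h1
      rw [cantorApprox_one] at h2
      rcases hb with hb | hb <;> rcases hb' with hb' | hb' <;>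
        first
        | exact absurd (hb.trans hb'.symm) e
        | rw [hb, hb'] at h ⊢
      all_goals
        norm_num at h ⊢
        linarith [ternaryPoint_le_one c, ternaryPoint_nonneg c']

theorem abs_ofDigits_sub_le (b b' : ℕ → Fin 2) (h : ternaryPoint b' ≤ ternaryPoint b) :
    |Real.ofDigits b - Real.ofDigits b'| ≤ (ternaryPoint b - ternaryPoint b') ^ cantorDim := by
  have ht : ∀ b : ℕ → Fin 2, Tendsto (fun n => cantorApprox n b) atTop (𝓝 (Real.ofDigits b)) := by
    intro b
    rw [tendsto_iff_norm_sub_tendsto_zero]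
    exact squeeze_zero (fun _ => norm_nonneg _) (fun n => abs_cantorApprox_sub_le n b)
      (tendsto_pow_atTop_nhds_zero_of_lt_one (by norm_num) (by norm_num))
  refine le_of_tendsto ((ht b).sub (ht b')).abs (Eventually.of_forall fun n => ?_)
  rw [abs_of_nonneg (by linarith [cantorApprox_mono n b b' h])]
  exact cantorApprox_sub_le n b b' h

/-- The digits of a point of the Cantor set are determined by the point. -/
theorem ternaryPoint_injective : Function.Injective ternaryPoint := by
  intro b b' h
  have := ofDigits_zero_two_sequence_unique (fun n => by split_ifs <;> simp)
    (fun n => by split_ifs <;> simp) h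
  funext i
  have := congrFun this i
  have hb : b i = 0 ∨ b i = 1 := by omega
  have hb' : b' i = 0 ∨ b' i = 1 := by omega
  rcases hb with hb | hb <;> rcases hb' with hb' | hb' <;> simp [hb, hb'] at this ⊢

theorem ternaryPoint_mem (b : ℕ → Fin 2) : ternaryPoint b ∈ cantorSet :=
  ofDigits_zero_two_sequence_mem_cantorSet fun n => by split_ifs <;> simp

theorem exists_ternaryPoint_eq {x : ℝ} (hx : x ∈ cantorSet) : ∃ b, ternaryPoint b = x := by
  rw [cantorSet_eq_zero_two_ofDigits] at hx
  obtain ⟨a, ha, rfl⟩ := hx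
  refine ⟨fun i => if a i = 0 then 0 else 1, ?_⟩
  rw [ternaryPoint]
  congr 1
  funext i
  have := ha i
  by_cases h : a i = 0
  · simp [h]
  · simp [h]; omega

/-- The Cantor function on the Cantor set. -/
noncomputable def cantorFunction (x : ℝ) : ℝ := Real.ofDigits (Function.invFun ternaryPoint x)

theorem cantorFunction_ternaryPoint (b : ℕ → Fin 2) :
    cantorFunction (ternaryPoint b) = Real.ofDigits b := by
  rw [cantorFunction, Function.leftInverse_invFun ternaryPoint_injective]

theorem holderOnWith_cantorFunction :
    HolderOnWith 1 cantorDim.toNNReal cantorFunction cantorSet := by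
  intro x hx y hy
  obtain ⟨b, rfl⟩ := exists_ternaryPoint_eq hx
  obtain ⟨b', rfl⟩ := exists_ternaryPoint_eq hy
  rw [cantorFunction_ternaryPoint, cantorFunction_ternaryPoint, ENNReal.coe_one, one_mul,
    edist_dist, edist_dist, Real.coe_toNNReal _ cantorDim_nonneg,
    ENNReal.ofReal_rpow_of_nonneg dist_nonneg cantorDim_nonneg]
  refine ENNReal.ofReal_le_ofReal ?_
  rw [Real.dist_eq, Real.dist_eq]
  rcases le_total (ternaryPoint b') (ternaryPoint b) with h | h
  · rw [abs_of_nonneg (sub_nonneg.2 h)]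
    exact abs_ofDigits_sub_le b b' h
  · rw [abs_sub_comm, abs_sub_comm (ternaryPoint b), abs_of_nonneg (sub_nonneg.2 h)]
    exact abs_ofDigits_sub_le b' b h

/-- The Cantor function maps C onto [0, 1] and is s-Hölder with constant 1, so the length of [0, 1]
is at most ℋˢ(C). -/
theorem one_le_hausdorffMeasure_cantorSet : 1 ≤ (μH[cantorDim] : Measure ℝ) cantorSet := by
  have h := holderOnWith_cantorFunction.hausdorffMeasure_image_le (d := 1)
    (by simpa using cantorDim_pos) (by norm_num)
  rw [hausdorffMeasure_real, mul_one, Real.coe_toNNReal _ cantorDim_nonneg, ENNReal.coe_one,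
    ENNReal.one_rpow, one_mul] at h
  refine le_trans ?_ h
  calc (1 : ℝ≥0∞) = volume (Icc (0 : ℝ) 1) := by simp
    _ ≤ _ := measure_mono ?_
  intro y hy
  obtain ⟨b, -, rfl⟩ := Real.ofDigits_SurjOn (b := 2) (by norm_num) hy
  exact ⟨ternaryPoint b, ternaryPoint_mem b, cantorFunction_ternaryPoint b⟩

/-! ### Characters of the solenoid -/

theorem Solenoid.ne_zero {N : ℕ} (z : Solenoid N) (n : ℤ) : z.1 n ≠ 0 := by
  have := (z.2 n).2
  intro h
  simp [h] at this

instance Solenoid.metrizableSpace (N : ℕ) : TopologicalSpace.MetrizableSpace (Solenoid N) :=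
  Topology.IsEmbedding.subtypeVal.metrizableSpace

theorem Solenoid.continuous_eval {N : ℕ} (n : ℤ) : Continuous fun z : Solenoid N => z.1 n :=
  (continuous_apply n).comp continuous_subtype_val

instance Solenoid.compactSpace (N : ℕ) : CompactSpace (Solenoid N) := by
  refine isCompact_iff_compactSpace.1 ?_
  refine (isCompact_univ_pi fun _ : ℤ => isCompact_closedBall (0 : ℂ) 1).of_isClosed_subset ?_ ?_
  · have : {z : ℤ → ℂ | ∀ n, z (n + 1) ^ N = z n ∧ ‖z n‖ = 1} =
        ⋂ n, {z : ℤ → ℂ | z (n + 1) ^ N = z n} ∩ {z | ‖z n‖ = 1} := by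
      ext z
      simp
    change IsClosed {z : ℤ → ℂ | ∀ n, z (n + 1) ^ N = z n ∧ ‖z n‖ = 1}
    rw [this]
    exact isClosed_iInter fun n => IsClosed.inter
      (isClosed_eq (by fun_prop) (by fun_prop)) (isClosed_eq (by fun_prop) (by fun_prop))
  · intro z hz n _
    simp [(hz n).2]

theorem continuous_character {N : ℕ} (k : ℤ) (p : ℕ) :
    Continuous (character k p : Solenoid N → ℂ) :=
  (Solenoid.continuous_eval (p : ℤ)).zpow₀ k fun z => Or.inl (z.ne_zero p)

theorem Solenoid.continuous_shift {N : ℕ} : Continuous (shift : Solenoid N → Solenoid N) :=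
  Continuous.subtype_mk (continuous_pi fun n => continuous_eval (n - 1)) _

theorem norm_character {N : ℕ} (k : ℤ) (p : ℕ) (z : Solenoid N) : ‖character k p z‖ = 1 := by
  simp [character, (z.2 p).2]

theorem character_mul (k k' : ℤ) (p p' : ℕ) (z : Solenoid 3) :
    character k p z * character k' p' z = character (k * 3 ^ p' + k' * 3 ^ p) (p + p') z := by
  have h1 : character k p z = character (k * 3 ^ p') (p + p') z :=
    character_congr (by norm_num) (by push_cast; field_simp; ring) z
  have h2 : character k' p' z = character (k' * 3 ^ p) (p + p') z :=
    character_congr (by norm_num) (by push_cast; field_simp; ring) z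
  rw [h1, h2, character, character, character, ← zpow_add₀ (z.ne_zero _)]

theorem star_character {N : ℕ} (k : ℤ) (p : ℕ) (z : Solenoid N) :
    starRingEnd ℂ (character k p z) = character (-k) p z := by
  rw [character, character, map_zpow₀, zpow_neg, ← inv_zpow]
  congr 1
  rw [Complex.inv_def, Complex.normSq_eq_norm_sq, (z.2 p).2]
  simp

theorem character_zero {N : ℕ} (p : ℕ) (z : Solenoid N) : character 0 p z = 1 := by
  simp [character]

theorem character_shift (k : ℤ) (p : ℕ) (z : Solenoid 3) :
    character k p z.shift = character (3 * k) p z := by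
  have h := (z.2 ((p : ℤ) - 1)).1
  rw [sub_add_cancel] at h
  rw [character, character, Solenoid.shift, ← h, zpow_mul]
  rfl

theorem Solenoid.ext_of_character {z w : Solenoid 3}
    (h : ∀ (k : ℤ) (p : ℕ), character k p z = character k p w) : z = w := by
  have hn : ∀ p : ℕ, z.1 p = w.1 p := fun p => by simpa [character] using h 1 p
  have key : ∀ (q : ℕ) (n : ℤ), z.1 (n + q) = w.1 (n + q) → z.1 n = w.1 n := by
    intro q
    induction q with
    | zero => intro n h; simpa using h
    | succ q ih =>
      intro n h
      rw [← (z.2 n).1, ← (w.2 n).1, ih (n + 1) (by convert h using 2 <;> push_cast <;> ring)]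
  -- Characters see only the coordinates with index ≥ 0; the others are powers of these. The offset
  -- |n| makes the index n + |n| nonnegative.
  refine Subtype.ext (funext fun n => key n.natAbs n ?_)
  have := hn (n + n.natAbs).toNat
  rwa [Int.toNat_of_nonneg (by omega)] at this

/-- The character `χ_λ`, as a continuous function. -/
noncomputable def characterMap (a : ℤ × ℕ) : C(Solenoid 3, ℂ) :=
  ⟨character a.1 a.2, continuous_character _ _⟩

/-- The characters are closed under products and contain 1, so the algebra they generate is just
their linear span. -/
theorem range_characterMap_mul :
    (Algebra.adjoin ℂ (range characterMap)).toSubmodule = Submodule.span ℂ (range characterMap) := by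
  refine Algebra.adjoin_eq_span_of_subset _ (Subset.trans ?_ Submodule.subset_span)
  intro x hx
  refine Submonoid.closure_induction (fun _ => id) ⟨(0, 0), ?_⟩ ?_ hx
  · ext z
    exact character_zero 0 z
  · rintro - - - - ⟨a, rfl⟩ ⟨b, rfl⟩
    refine ⟨(a.1 * 3 ^ b.2 + b.1 * 3 ^ a.2, a.2 + b.2), ?_⟩
    ext z
    exact (character_mul _ _ _ _ z).symm

theorem star_characterMap (a : ℤ × ℕ) : star (characterMap a) = characterMap (-a.1, a.2) := by
  ext z
  exact star_character _ _ z

/-- The algebra of trigonometric polynomials on the solenoid. -/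
noncomputable def trigPolynomials : StarSubalgebra ℂ C(Solenoid 3, ℂ) where
  toSubalgebra := Algebra.adjoin ℂ (range characterMap)
  star_mem' := by
    change Algebra.adjoin ℂ (range characterMap) ≤ star (Algebra.adjoin ℂ (range characterMap))
    refine Algebra.adjoin_le ?_
    rintro - ⟨a, rfl⟩
    exact Algebra.subset_adjoin ⟨(-a.1, a.2), (star_characterMap a).symm⟩

theorem trigPolynomials_separatesPoints : trigPolynomials.SeparatesPoints := by
  intro z w hzw
  by_contra! h
  refine hzw (Solenoid.ext_of_character fun k p => ?_)
  exact h _ ⟨characterMap (k, p), Algebra.subset_adjoin ⟨_, rfl⟩, rfl⟩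

theorem span_characterMap_closure :
    (Submodule.span ℂ (range characterMap)).topologicalClosure = ⊤ := by
  rw [← range_characterMap_mul]
  exact congr_arg (Subalgebra.toSubmodule <| StarSubalgebra.toSubalgebra ·)
    (ContinuousMap.starSubalgebra_topologicalClosure_eq_top_of_separatesPoints trigPolynomials
      trigPolynomials_separatesPoints)

/-- The character `χ_λ` as an element of `L²`. -/
noncomputable def characterL2 (m : Measure (Solenoid 3)) [IsFiniteMeasure m] (a : ℤ × ℕ) :
    Lp ℂ 2 m :=
  ContinuousMap.toLp 2 m ℂ (characterMap a)

theorem coeFn_characterL2 (m : Measure (Solenoid 3)) [IsFiniteMeasure m] (a : ℤ × ℕ) :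
    characterL2 m a =ᵐ[m] character a.1 a.2 :=
  ContinuousMap.coeFn_toLp m (characterMap a)

theorem span_characterL2_closure (m : Measure (Solenoid 3)) [IsFiniteMeasure m] :
    (Submodule.span ℂ (range (characterL2 m))).topologicalClosure = ⊤ := by
  convert!
    (ContinuousMap.toLp_denseRange ℂ m ℂ
      (by simp : (2 : ℝ≥0∞) ≠ ∞)).topologicalClosure_map_submodule span_characterMap_closure
  rw [Submodule.map_span, ← range_comp]
  rfl

theorem integrable_character (m : Measure (Solenoid 3)) [IsFiniteMeasure m] (k : ℤ) (p : ℕ) :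
    Integrable (character k p) m :=
  (continuous_character k p).integrable_of_hasCompactSupport (HasCompactSupport.of_compactSpace _)

theorem inner_characterL2 (m : Measure (Solenoid 3)) [IsFiniteMeasure m] (a b : ℤ × ℕ) :
    inner ℂ (characterL2 m a) (characterL2 m b) =
      ∫ z, character (b.1 * 3 ^ a.2 - a.1 * 3 ^ b.2) (b.2 + a.2) z ∂m := by
  rw [characterL2, characterL2, ContinuousMap.inner_toLp m]
  refine integral_congr_ae (Eventually.of_forall fun z => ?_)
  simp only [characterMap, ContinuousMap.coe_mk]
  rw [star_character, character_mul]
  congr 1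
  ring

theorem continuous_integral_of_finite (m : Measure (Solenoid 3)) [IsFiniteMeasure m] :
    Continuous fun f : C(Solenoid 3, ℂ) => ∫ z, f z ∂m := by
  have : (fun f : C(Solenoid 3, ℂ) => ∫ z, f z ∂m) =
      fun f => ∫ z, (ContinuousMap.toLp (E := ℂ) 1 m ℂ f) z ∂m := by
    funext f
    exact integral_congr_ae (ContinuousMap.coeFn_toLp m f).symm
  rw [this]
  exact continuous_integral.comp (ContinuousMap.toLp 1 m ℂ).continuous

/-- A finite measure on the solenoid is determined by its Fourier coefficients. -/
theorem ext_of_integral_character {m m' : Measure (Solenoid 3)} [IsFiniteMeasure m]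
    [IsFiniteMeasure m']
    (h : ∀ (k : ℤ) (p : ℕ), ∫ z, character k p z ∂m = ∫ z, character k p z ∂m') : m = m' := by
  have hspan : ∀ f ∈ Submodule.span ℂ (range characterMap), ∫ z, f z ∂m = ∫ z, f z ∂m' := by
    intro f hf
    induction hf using Submodule.span_induction with
    | mem f hf =>
      obtain ⟨a, rfl⟩ := hf
      exact h a.1 a.2
    | zero => simp
    | add f g _ _ hf hg =>
      have hi : ∀ (μ : Measure (Solenoid 3)) [IsFiniteMeasure μ] (f : C(Solenoid 3, ℂ)),
          Integrable f μ := fun μ _ f =>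
        f.continuous.integrable_of_hasCompactSupport (HasCompactSupport.of_compactSpace _)
      simp only [ContinuousMap.add_apply]
      rw [integral_add (hi m f) (hi m g), integral_add (hi m' f) (hi m' g), hf, hg]
    | smul c f _ hf =>
      simp only [ContinuousMap.smul_apply]
      rw [integral_smul, integral_smul, hf]
  have hall : ∀ f : C(Solenoid 3, ℂ), ∫ z, f z ∂m = ∫ z, f z ∂m' := by
    intro f
    have hf : f ∈ closure (Submodule.span ℂ (range characterMap) : Set C(Solenoid 3, ℂ)) := by
      rw [← Submodule.topologicalClosure_coe, span_characterMap_closure]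
      trivial
    exact closure_minimal hspan (isClosed_eq (continuous_integral_of_finite m)
      (continuous_integral_of_finite m')) hf
  let : MetricSpace (Solenoid 3) := TopologicalSpace.metrizableSpaceMetric _
  refine ext_of_forall_integral_eq_of_IsFiniteMeasure fun f => ?_
  have := hall ⟨fun z => (f z : ℂ), by fun_prop⟩
  simp only [ContinuousMap.coe_mk] at this
  rw [integral_complex_ofReal, integral_complex_ofReal] at this
  exact_mod_cast this

/-! ### Existence of the measure on the solenoid -/

/-- The one-parameter subgroup `t ↦ (exp (2 π i t / 3 ^ n))ₙ` of the solenoid. -/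
noncomputable def winding (t : ℝ) : Solenoid 3 :=
  ⟨fun n => Complex.exp ((2 * Real.pi * (t / 3 ^ n) : ℝ) * Complex.I), fun n => by
    refine ⟨?_, Complex.norm_exp_ofReal_mul_I _⟩
    rw [← Complex.exp_nat_mul, zpow_add₀ (by norm_num)]
    congr 1
    push_cast
    field_simp⟩

theorem continuous_winding : Continuous winding := by
  refine Continuous.subtype_mk (continuous_pi fun n => ?_) _
  fun_prop

theorem character_winding (k : ℤ) (p : ℕ) (t : ℝ) :
    character k p (winding t) =
      Complex.exp ((2 * Real.pi * ((k / 3 ^ p : ℝ) * t) : ℝ) * Complex.I) := by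
  rw [character, winding, ← Complex.exp_int_mul]
  congr 1
  push_cast
  rw [zpow_natCast]
  ring

/-- The partial Riesz products `∏ (1 + cos (4 π t / 3 ⁱ))`, `1 ≤ i ≤ n`. -/
noncomputable def rieszProduct (n : ℕ) (t : ℝ) : ℝ :=
  ∏ i ∈ Finset.range n, (1 + Real.cos (4 * Real.pi * t / 3 ^ (i + 1)))

theorem continuous_rieszProduct (n : ℕ) : Continuous (rieszProduct n) := by
  unfold rieszProduct
  fun_prop

theorem rieszProduct_nonneg (n : ℕ) (t : ℝ) : 0 ≤ rieszProduct n t :=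
  Finset.prod_nonneg fun i _ => by linarith [Real.neg_one_le_cos (4 * Real.pi * t / 3 ^ (i + 1))]

theorem rieszProduct_succ (n : ℕ) (t : ℝ) :
    rieszProduct (n + 1) (3 * t) = rieszProduct n t * (1 + Real.cos (4 * Real.pi * t)) := by
  rw [rieszProduct, Finset.prod_range_succ', rieszProduct]
  congr 1
  · refine Finset.prod_congr rfl fun i _ => ?_
    congr 2
    field_simp
    ring
  · congr 2
    field_simp
    ring

/-- The Fourier transform of the partial Riesz products. -/
noncomputable def rieszTransform (n : ℕ) (x : ℝ) : ℂ :=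
  ∫ t in (0 : ℝ)..3 ^ n,
    ((rieszProduct n t / 3 ^ n : ℝ) : ℂ) * Complex.exp ((2 * Real.pi * (x * t) : ℝ) * Complex.I)

theorem rieszTransform_zero (k : ℤ) : rieszTransform 0 k = if k = 0 then 1 else 0 := by
  rw [rieszTransform]
  split_ifs with h
  · simp [rieszProduct, h]
  · have hc : (2 * Real.pi * k * Complex.I : ℂ) ≠ 0 := by
      simp [Real.pi_ne_zero, h]
    have := integral_exp_mul_complex (a := 0) (b := 1) hc
    calc _ = ∫ x in (0 : ℝ)..1, Complex.exp (2 * Real.pi * k * Complex.I * x) := by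
          rw [pow_zero]
          refine intervalIntegral.integral_congr fun t _ => ?_
          simp only [rieszProduct, Finset.range_zero, Finset.prod_empty]
          norm_num
          congr 1
          ring
      _ = 0 := by
          rw [this]
          have : Complex.exp (2 * Real.pi * k * Complex.I * (1 : ℝ)) = 1 :=
            Complex.exp_eq_one_iff.2 ⟨k, by push_cast; ring⟩
          rw [this]
          simp

/-- Substituting t ↦ 3t isolates the factor 1 + cos(4πt), whose exponentials shift the frequency 3x
by ±2. This is the recursion defining `coef`. -/
theorem rieszTransform_succ (n : ℕ) (x : ℝ) :
    rieszTransform (n + 1) x = rieszTransform n (3 * x) + 1 / 2 * rieszTransform n (3 * x + 2) +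
      1 / 2 * rieszTransform n (3 * x - 2) := by
  have hint : ∀ y : ℝ, IntervalIntegrable (fun t : ℝ => ((rieszProduct n t / 3 ^ n : ℝ) : ℂ) *
      Complex.exp ((2 * Real.pi * (y * t) : ℝ) * Complex.I)) volume 0 (3 ^ n) := by
    intro y
    have := continuous_rieszProduct n
    exact Continuous.intervalIntegrable (by fun_prop) _ _
  simp only [rieszTransform]
  rw [← intervalIntegral.integral_const_mul, ← intervalIntegral.integral_const_mul,
    ← intervalIntegral.integral_add (hint _) ((hint _).const_mul _),
    ← intervalIntegral.integral_add ((hint _).add ((hint _).const_mul _)) ((hint _).const_mul _)]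
  have h := intervalIntegral.smul_integral_comp_mul_left (a := 0) (b := 3 ^ n)
    (fun t : ℝ => ((rieszProduct (n + 1) t / 3 ^ (n + 1) : ℝ) : ℂ) *
      Complex.exp ((2 * Real.pi * (x * t) : ℝ) * Complex.I)) 3
  rw [mul_zero, ← pow_succ'] at h
  rw [← h, ← intervalIntegral.integral_smul]
  refine intervalIntegral.integral_congr fun t _ => ?_
  simp only [rieszProduct_succ]
  have hcos : (Real.cos (4 * Real.pi * t) : ℂ) =
      (Complex.exp ((2 * Real.pi * (2 * t) : ℝ) * Complex.I) +
        Complex.exp (-((2 * Real.pi * (2 * t) : ℝ) * Complex.I))) / 2 := by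
    rw [Complex.ofReal_cos, Complex.cos]
    push_cast
    ring_nf
  have e1 : Complex.exp ((2 * Real.pi * ((3 * x + 2) * t) : ℝ) * Complex.I) =
      Complex.exp ((2 * Real.pi * ((3 * x) * t) : ℝ) * Complex.I) *
        Complex.exp ((2 * Real.pi * (2 * t) : ℝ) * Complex.I) := by
    rw [← Complex.exp_add]
    push_cast
    ring_nf
  have e2 : Complex.exp ((2 * Real.pi * ((3 * x - 2) * t) : ℝ) * Complex.I) =
      Complex.exp ((2 * Real.pi * ((3 * x) * t) : ℝ) * Complex.I) *
        Complex.exp (-((2 * Real.pi * (2 * t) : ℝ) * Complex.I)) := by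
    rw [← Complex.exp_add]
    push_cast
    ring_nf
  have e3 : 2 * Real.pi * (x * (3 * t)) = 2 * Real.pi * ((3 * x) * t) := by ring
  rw [e1, e2, e3, Complex.real_smul]
  generalize Complex.exp ((2 * Real.pi * ((3 * x) * t) : ℝ) * Complex.I) = A
  push_cast [hcos, pow_succ]
  field_simp
  ring

/-- In the recursion the frequencies 3k ± 2 are never 0, and 3k is 0 only for k = 0. -/
theorem rieszTransform_int (n : ℕ) (k : ℤ) :
    rieszTransform n k = if k = 0 then 1 else 0 := by
  induction n generalizing k with
  | zero => exact rieszTransform_zero k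
  | succ n ih =>
    have h0 := ih (3 * k)
    have h1 := ih (3 * k + 2)
    have h2 := ih (3 * k - 2)
    have h3 : 3 * k + 2 ≠ 0 := by omega
    have h4 : 3 * k - 2 ≠ 0 := by omega
    push_cast at h0 h1 h2
    rw [rieszTransform_succ, h0, h1, h2]
    simp [h3, h4]

/-- Each use of the recursion lowers `n` and `p` together; after `p` of them the frequency is an
integer. So the coefficient at k / 3^p is constant from `n = p` on. -/
theorem rieszTransform_eq_coef (p n : ℕ) (h : p ≤ n) (k : ℤ) :
    rieszTransform n (k / 3 ^ p) = coef p k := by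
  induction p generalizing n k with
  | zero =>
    rw [pow_zero, div_one, rieszTransform_int, coef]
    split_ifs <;> simp
  | succ p ih =>
    obtain ⟨n, rfl⟩ : ∃ n', n = n' + 1 := ⟨n - 1, by omega⟩
    have h' : p ≤ n := by omega
    have h0 := ih n h' k
    have h1 := ih n h' (k + 2 * 3 ^ p)
    have h2 := ih n h' (k - 2 * 3 ^ p)
    push_cast at h1 h2
    rw [rieszTransform_succ, coef_succ,
      show 3 * ((k : ℝ) / 3 ^ (p + 1)) + 2 = (k + 2 * 3 ^ p) / 3 ^ p by field_simp; ring,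
      show 3 * ((k : ℝ) / 3 ^ (p + 1)) - 2 = (k - 2 * 3 ^ p) / 3 ^ p by field_simp; ring,
      show 3 * ((k : ℝ) / 3 ^ (p + 1)) = k / 3 ^ p by field_simp; ring, h0, h1, h2]
    push_cast
    ring

/-- The image of the partial Riesz product in the solenoid. -/
noncomputable def rieszMeasure (n : ℕ) : Measure (Solenoid 3) :=
  ((volume.restrict (Ioc (0 : ℝ) (3 ^ n))).withDensity
    fun t => ENNReal.ofReal (rieszProduct n t / 3 ^ n)).map winding

theorem integral_character_rieszMeasure (k : ℤ) {p n : ℕ} (h : p ≤ n) :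
    ∫ z, character k p z ∂(rieszMeasure n) = coef p k := by
  rw [← rieszTransform_eq_coef p n h, rieszMeasure,
    integral_map continuous_winding.aemeasurable
      (continuous_character k p).aestronglyMeasurable,
    integral_withDensity_eq_integral_toReal_smul
      (by have := continuous_rieszProduct n; fun_prop) (by simp),
    rieszTransform, intervalIntegral.integral_of_le (by positivity)]
  refine integral_congr_ae (Eventually.of_forall fun t => ?_)
  simp only
  rw [character_winding, ENNReal.toReal_ofReal (by have := rieszProduct_nonneg n t; positivity),
    Complex.real_smul]

instance isProbabilityMeasure_rieszMeasure (n : ℕ) : IsProbabilityMeasure (rieszMeasure n) := by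
  have h := integral_character_rieszMeasure 0 (Nat.zero_le n)
  simp only [character_zero, coef, if_true] at h
  rw [integral_const] at h
  have h' : (rieszMeasure n).real univ = 1 := by simpa using h
  exact ⟨(ENNReal.toReal_eq_one_iff _).1 h'⟩

/-- There is a probability measure on the solenoid with the prescribed Fourier coefficients. -/
theorem exists_hasCantorCoefficients :
    ∃ m : Measure (Solenoid 3), IsProbabilityMeasure m ∧ HasCantorCoefficients m := by
  let μ : ℕ → ProbabilityMeasure (Solenoid 3) := fun n => ⟨rieszMeasure n, inferInstance⟩
  have : Nonempty (ProbabilityMeasure (Solenoid 3)) := ⟨μ 0⟩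
  -- Probability measures on the compact solenoid form a compact space, so an ultrafilter limit
  -- exists and no subsequence has to be chosen.
  let F : Ultrafilter (ProbabilityMeasure (Solenoid 3)) := (Ultrafilter.of atTop).map μ
  have hF : Tendsto μ (Ultrafilter.of (atTop : Filter ℕ)) (𝓝 F.lim) := F.le_nhds_lim
  refine ⟨F.lim, inferInstance, hasCantorCoefficients_iff.2 fun k p => ?_⟩
  have h1 := (ProbabilityMeasure.tendsto_iff_forall_integral_rclike_tendsto ℂ).1 hF
    (BoundedContinuousFunction.mkOfCompact (characterMap (k, p)))
  refine tendsto_nhds_unique h1 (tendsto_const_nhds.congr' ?_)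
  filter_upwards [Ultrafilter.of_le _ (eventually_ge_atTop p)] with n hn
  exact (integral_character_rieszMeasure k hn).symm

theorem existsUnique_hasCantorCoefficients :
    ∃! m : Measure (Solenoid 3), IsProbabilityMeasure m ∧ HasCantorCoefficients m := by
  obtain ⟨m, hm, hc⟩ := exists_hasCantorCoefficients
  refine ⟨m, ⟨hm, hc⟩, fun m' ⟨hm', hc'⟩ => ext_of_integral_character fun k p => ?_⟩
  rw [hasCantorCoefficients_iff.1 hc, hasCantorCoefficients_iff.1 hc']

/-! ### The measure of the Cantor set -/

/-- Stage n of the construction covers C by 2ⁿ intervals of length 3⁻ⁿ, and 2ⁿ (3⁻ⁿ)ˢ = 1. -/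
theorem hausdorffMeasure_cantorSet_le_one : (μH[cantorDim] : Measure ℝ) cantorSet ≤ 1 := by
  let w : (n : ℕ) → (Fin n → Bool) → ℕ → Fin 3 := fun n b i =>
    if h : i < n then cond (b ⟨i, h⟩) 2 0 else 0
  let a : (n : ℕ) → (Fin n → Bool) → ℝ := fun n b =>
    ∑ i ∈ Finset.range n, Real.ofDigitsTerm (w n b) i
  let t : (n : ℕ) → (Fin n → Bool) → Set ℝ := fun n b => Icc (a n b) (a n b + 3⁻¹ ^ n)
  have hd : ∀ n b, Metric.ediam (t n b) = (3⁻¹ : ℝ≥0∞) ^ n := by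
    intro n b
    simp only [t, Real.ediam_Icc, add_sub_cancel_left]
    rw [ENNReal.ofReal_pow (by norm_num), ENNReal.ofReal_inv_of_pos (by norm_num)]
    simp
  refine (hausdorffMeasure_le_liminf_sum (l := atTop) cantorDim cantorSet
    (fun n : ℕ => (3⁻¹ : ℝ≥0∞) ^ n) ?_ t ?_ ?_).trans ?_
  · exact ENNReal.tendsto_pow_atTop_nhds_zero_of_lt_one (ENNReal.inv_lt_one.2 (by norm_num))
  · exact Eventually.of_forall fun n b => (hd n b).le
  · refine Eventually.of_forall fun n x hx => mem_iUnion.2 ⟨fun i => (cantorToBinary x).get i, ?_⟩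
    have e : a n (fun i => (cantorToBinary x).get i) =
        ∑ i ∈ Finset.range n, Real.ofDigitsTerm (cantorToTernary x) i := by
      refine Finset.sum_congr rfl fun i hi => ?_
      have hi' := Finset.mem_range.1 hi
      have e' : w n (fun i => (cantorToBinary x).get i) i = (cantorToTernary x) i := by
        simp only [w, dif_pos hi']
        rfl
      simp only [Real.ofDigitsTerm, e']
    simp only [t, mem_Icc, e]
    exact ⟨ofDigits_cantorToTernary_sum_le hx, by
      linarith [le_ofDigits_cantorToTernary_sum hx (n := n)]⟩
  · simp only [hd]
    have e : ∀ n : ℕ, ((3⁻¹ : ℝ≥0∞) ^ n) ^ cantorDim = 2⁻¹ ^ n := by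
      intro n
      rw [← ENNReal.rpow_natCast, ← ENNReal.rpow_mul, mul_comm, ENNReal.rpow_mul,
        ENNReal.inv_rpow, three_rpow_cantorDim, ENNReal.rpow_natCast]
    simp only [e, Finset.sum_const, Finset.card_univ, Fintype.card_fun, Fintype.card_bool,
      Fintype.card_fin, nsmul_eq_mul]
    push_cast
    simp only [← mul_pow, ENNReal.mul_inv_cancel (by norm_num : (2 : ℝ≥0∞) ≠ 0) (by norm_num),
      one_pow, liminf_const, le_refl]

theorem cantorSet_subset_finOnes : cantorSet ⊆ finOnes := fun c hc => by
  simpa using int_add_mem 0 hc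

theorem fractalMeasure_cantorSet : fractalMeasure cantorSet = 1 := by
  rw [fractalMeasure, Measure.restrict_apply isClosed_cantorSet.measurableSet,
    inter_eq_self_of_subset_left cantorSet_subset_finOnes]
  exact le_antisymm hausdorffMeasure_cantorSet_le_one one_le_hausdorffMeasure_cantorSet

instance nullSingletonClass_fractalMeasure : NullSingletonClass fractalMeasure := by
  have : NullSingletonClass (μH[cantorDim] : Measure ℝ) := nullSingletonClass_hausdorff ℝ cantorDim_pos
  unfold fractalMeasure
  infer_instance

theorem measurePreserving_dilation_quasi :
    QuasiMeasurePreserving (fun x : ℝ => x / 3) fractalMeasure fractalMeasure :=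
  ⟨measurePreserving_div.measurable, by
    rw [measurePreserving_div.map_eq]
    exact Measure.smul_absolutelyContinuous⟩

/-! ### Algebra of translations and dilation -/

theorem coeFn_translation (k : ℤ) (p : ℕ) (f : FractalL2) :
    translation k p f =ᵐ[fractalMeasure] fun x => f (x - k / 3 ^ p) :=
  (memLp_translation k p f).coeFn_toLp

theorem coeFn_dilation (f : FractalL2) :
    dilation f =ᵐ[fractalMeasure] fun x => ((1 / √2 : ℝ) : ℂ) * f (x / 3) :=
  (memLp_dilation f).coeFn_toLp

/-- Translation as a linear isometry. -/
noncomputable def translationIsometry (k : ℤ) (p : ℕ) : FractalL2 →ₗᵢ[ℂ] FractalL2 :=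
  Lp.compMeasurePreservingₗᵢ ℂ _ (measurePreserving_sub k p)

theorem translationIsometry_apply (k : ℤ) (p : ℕ) (f : FractalL2) :
    translationIsometry k p f = translation k p f := by
  refine Lp.ext ?_
  exact (Lp.coeFn_compMeasurePreserving f (measurePreserving_sub k p)).trans
    (coeFn_translation k p f).symm

theorem inner_translation (k : ℤ) (p : ℕ) (f g : FractalL2) :
    inner ℂ (translation k p f) (translation k p g) = inner ℂ f g := by
  rw [← translationIsometry_apply, ← translationIsometry_apply, LinearIsometry.inner_map_map]

theorem translation_add (k : ℤ) (p : ℕ) (f g : FractalL2) :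
    translation k p (f + g) = translation k p f + translation k p g := by
  simp only [← translationIsometry_apply, map_add]

theorem translation_smul (k : ℤ) (p : ℕ) (c : ℂ) (f : FractalL2) :
    translation k p (c • f) = c • translation k p f := by
  simp only [← translationIsometry_apply, map_smul]

/-- The hypothesis is an equation of real numbers because a triadic rational has many
representations (k, p); callers choose a convenient one. -/
theorem translation_translation {k k' l : ℤ} {p p' q : ℕ}
    (h : (k : ℝ) / 3 ^ p + k' / 3 ^ p' = l / 3 ^ q) (f : FractalL2) :
    translation k p (translation k' p' f) = translation l q f := by
  refine Lp.ext ?_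
  filter_upwards [coeFn_translation k p (translation k' p' f), coeFn_translation l q f,
    (measurePreserving_sub k p).quasiMeasurePreserving.ae_eq_comp (coeFn_translation k' p' f)]
    with x h1 h2 h3
  simp only [Function.comp_apply] at h3
  rw [h1, h2, h3, ← h]
  congr 1
  ring

theorem translation_zero (p : ℕ) (f : FractalL2) : translation 0 p f = f := by
  refine Lp.ext ?_
  filter_upwards [coeFn_translation 0 p f] with x h
  rw [h]
  simp

theorem dilation_translation {k l : ℤ} {p q : ℕ} (h : 3 * ((k : ℝ) / 3 ^ p) = l / 3 ^ q)
    (f : FractalL2) : dilation (translation k p f) = translation l q (dilation f) := by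
  refine Lp.ext ?_
  filter_upwards [coeFn_dilation (translation k p f), coeFn_translation l q (dilation f),
    measurePreserving_dilation_quasi.ae_eq_comp (coeFn_translation k p f),
    (measurePreserving_sub l q).quasiMeasurePreserving.ae_eq_comp (coeFn_dilation f)]
    with x h1 h2 h3 h4
  simp only [Function.comp_apply] at h3 h4
  rw [h1, h2, h3, h4, ← h]
  congr 2
  ring

theorem dilation_add (f g : FractalL2) : dilation (f + g) = dilation f + dilation g := by
  refine Lp.ext ?_
  filter_upwards [coeFn_dilation (f + g), coeFn_dilation f, coeFn_dilation g,
    Lp.coeFn_add (dilation f) (dilation g),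
    measurePreserving_dilation_quasi.ae_eq_comp (Lp.coeFn_add f g)] with x h1 h2 h3 h4 h5
  simp only [Function.comp_apply, Pi.add_apply] at h5
  rw [h1, h4, Pi.add_apply, h2, h3, h5, mul_add]

theorem dilation_smul (c : ℂ) (f : FractalL2) : dilation (c • f) = c • dilation f := by
  refine Lp.ext ?_
  filter_upwards [coeFn_dilation (c • f), coeFn_dilation f, Lp.coeFn_smul c (dilation f),
    measurePreserving_dilation_quasi.ae_eq_comp (Lp.coeFn_smul c f)] with x h1 h2 h3 h4
  simp only [Function.comp_apply, Pi.smul_apply, smul_eq_mul] at h4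
  rw [h1, h3, Pi.smul_apply, h2, h4, smul_eq_mul]
  ring

/-- The image of the measure under x ↦ x / 3 is twice the measure, which cancels the square of 1/√2.
-/
theorem inner_dilation (f g : FractalL2) : inner ℂ (dilation f) (dilation g) = inner ℂ f g := by
  rw [L2.inner_def, L2.inner_def]
  have h2 : (√2 : ℝ) * √2 = 2 := Real.mul_self_sqrt (by norm_num)
  have hc : ((√2 : ℝ) : ℂ) * ((√2 : ℝ) : ℂ) = 2 := by exact_mod_cast h2
  have hm : AEStronglyMeasurable (fun x => inner ℂ (f x) (g x)) ((2 : ℝ≥0∞) • fractalMeasure) :=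
    ((Lp.aestronglyMeasurable f).inner (Lp.aestronglyMeasurable g)).smul_measure 2
  calc ∫ x, inner ℂ (dilation f x) (dilation g x) ∂fractalMeasure
      = ∫ x, (1 / 2 : ℂ) * inner ℂ (f (x / 3)) (g (x / 3)) ∂fractalMeasure := by
        refine integral_congr_ae ?_
        filter_upwards [coeFn_dilation f, coeFn_dilation g] with x h1 h3
        rw [h1, h3]
        simp only [RCLike.inner_apply, map_mul, Complex.conj_ofReal]
        rw [show ∀ a b c : ℂ, a * b * (a * c) = (a * a) * (b * c) by intros; ring]
        congr 1
        push_cast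
        rw [div_mul_div_comm, hc]
        norm_num
    _ = 1 / 2 * ∫ x, inner ℂ (f x) (g x) ∂(fractalMeasure.map fun x : ℝ => x / 3) := by
        rw [integral_const_mul, integral_map measurePreserving_div.aemeasurable
          (measurePreserving_div.map_eq ▸ hm)]
    _ = _ := by
        rw [measurePreserving_div.map_eq, integral_smul_measure]
        simp

/-- Dilation as a linear isometry. -/
noncomputable def dilationIsometry : FractalL2 →ₗᵢ[ℂ] FractalL2 :=
  LinearMap.isometryOfInner ⟨⟨dilation, dilation_add⟩, dilation_smul⟩ inner_dilation

theorem dilationIsometry_apply (f : FractalL2) : dilationIsometry f = dilation f := rfl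

/-! ### Self-similarity of the Cantor set and its correlations -/

theorem coeFn_cantorIndicator :
    cantorIndicator =ᵐ[fractalMeasure] cantorSet.indicator fun _ => (1 : ℂ) :=
  indicatorConstLp_coeFn

theorem mem_cantorSet_iff_three_mul {x : ℝ} :
    x ∈ cantorSet ↔ 3 * x ∈ cantorSet ∨ 3 * x - 2 ∈ cantorSet := by
  conv_lhs => rw [cantorSet_eq_union_halves]
  simp only [mem_union, mem_image]
  constructor
  · rintro (⟨y, hy, rfl⟩ | ⟨y, hy, rfl⟩)
    · left; convert hy using 1; ring
    · right; convert hy using 1; ring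
  · rintro (h | h)
    · exact Or.inl ⟨_, h, by ring⟩
    · exact Or.inr ⟨_, h, by ring⟩

theorem indicator_cantorSet_div_three (x : ℝ) :
    cantorSet.indicator (fun _ => (1 : ℂ)) (x / 3) =
      cantorSet.indicator (fun _ => 1) x + cantorSet.indicator (fun _ => 1) (x - 2) := by
  have h := mem_cantorSet_iff_three_mul (x := x / 3)
  rw [mul_div_cancel₀ x (by norm_num : (3 : ℝ) ≠ 0)] at h
  have hd : ¬ (x ∈ cantorSet ∧ x - 2 ∈ cantorSet) := fun ⟨h1, h2⟩ => by
    linarith [(cantorSet_subset_unitInterval h1).2, (cantorSet_subset_unitInterval h2).1]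
  by_cases h1 : x ∈ cantorSet <;> by_cases h2 : x - 2 ∈ cantorSet <;> simp [h1, h2, h] at hd ⊢

theorem dilation_cantorIndicator :
    dilation cantorIndicator =
      ((1 / √2 : ℝ) : ℂ) • (cantorIndicator + translation 2 0 cantorIndicator) := by
  refine Lp.ext ?_
  filter_upwards [coeFn_dilation cantorIndicator, coeFn_cantorIndicator,
    coeFn_translation 2 0 cantorIndicator,
    Lp.coeFn_smul ((1 / √2 : ℝ) : ℂ) (cantorIndicator + translation 2 0 cantorIndicator),
    Lp.coeFn_add cantorIndicator (translation 2 0 cantorIndicator),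
    measurePreserving_dilation_quasi.ae_eq_comp coeFn_cantorIndicator,
    (measurePreserving_sub 2 0).quasiMeasurePreserving.ae_eq_comp coeFn_cantorIndicator]
    with x h1 h2 h3 h4 h5 h6 h7
  simp only [Function.comp_apply] at h6 h7
  rw [h1, h4, Pi.smul_apply, h5, Pi.add_apply, h3, h7, h6, h2, smul_eq_mul,
    indicator_cantorSet_div_three]
  simp

/-- For an integer k ≠ 0 the sets C and C + k meet at most in an endpoint of [0, 1], and points have
measure zero. -/
theorem inner_translation_int (k : ℤ) :
    inner ℂ (translation k 0 cantorIndicator) cantorIndicator = (if k = 0 then 1 else 0 : ℂ) := by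
  have h : inner ℂ (translation k 0 cantorIndicator) cantorIndicator =
      ∫ x, ({x : ℝ | x - k ∈ cantorSet} ∩ cantorSet).indicator (fun _ => (1 : ℂ)) x
        ∂fractalMeasure := by
    rw [L2.inner_def]
    refine integral_congr_ae ?_
    filter_upwards [coeFn_cantorIndicator, coeFn_translation k 0 cantorIndicator,
      (measurePreserving_sub k 0).quasiMeasurePreserving.ae_eq_comp coeFn_cantorIndicator]
      with x h1 h2 h3
    simp only [Function.comp_apply, pow_zero, div_one] at h2 h3
    rw [h1, h2, h3]
    by_cases h4 : x ∈ cantorSet <;> by_cases h5 : x - k ∈ cantorSet <;> simp [h4, h5]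
  rw [h]
  split_ifs with hk
  · simp only [hk, Int.cast_zero, sub_zero, ofPred_mem_eq, inter_self]
    rw [integral_indicator_const _ isClosed_cantorSet.measurableSet, Measure.real,
      fractalMeasure_cantorSet]
    simp
  · refine integral_eq_zero_of_ae ?_
    have hsub : {x : ℝ | x - k ∈ cantorSet} ∩ cantorSet ⊆ ({0, 1} : Set ℝ) := by
      rintro x ⟨h1, h2⟩
      obtain ⟨h3, h4⟩ := cantorSet_subset_unitInterval h1
      obtain ⟨h5, h6⟩ := cantorSet_subset_unitInterval h2
      rcases lt_or_gt_of_ne hk with hk | hk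
      · have : (k : ℝ) ≤ -1 := by exact_mod_cast (by omega : k ≤ -1)
        left; linarith
      · have : (1 : ℝ) ≤ k := by exact_mod_cast hk
        right; simp only [mem_singleton_iff]; linarith
    have h0 : fractalMeasure ({0, 1} : Set ℝ) = 0 :=
      (Set.toFinite _).countable.measure_zero _
    exact indicator_meas_zero (measure_mono_null hsub h0)

/-- The correlations of the Cantor set with its translates. -/
theorem inner_translation_cantorIndicator (k : ℤ) (p : ℕ) :
    inner ℂ (translation k p cantorIndicator) cantorIndicator = (coef p k : ℂ) := by
  induction p generalizing k with
  | zero =>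
    rw [inner_translation_int, coef]
    split_ifs <;> simp
  | succ p ih =>
    have h2 : (√2 : ℝ) * √2 = 2 := Real.mul_self_sqrt (by norm_num)
    have hc : ((√2 : ℝ) : ℂ) * ((√2 : ℝ) : ℂ) = 2 := by exact_mod_cast h2
    -- Both entries are dilated, with U T_λ = T_{3λ} U and the refinement equation for U χ_C. The
    -- four resulting inner products are integer shifts of 3λ = k / 3^p, which is the recursion of
    -- `coef`.
    rw [← inner_dilation, dilation_translation (l := k) (q := p) (by field_simp; ring),
      dilation_cantorIndicator, translation_smul, translation_add, inner_smul_left,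
      inner_smul_right, inner_add_left, inner_add_right, inner_add_right, ih]
    have e1 : inner ℂ (translation k p cantorIndicator) (translation 2 0 cantorIndicator) =
        (coef p (k - 2 * 3 ^ p) : ℂ) := by
      rw [← translation_translation (k := 2) (p := 0) (k' := k - 2 * 3 ^ p) (p' := p)
        (by push_cast; field_simp; ring), inner_translation, ih]
    have e2 : inner ℂ (translation k p (translation 2 0 cantorIndicator)) cantorIndicator =
        (coef p (k + 2 * 3 ^ p) : ℂ) := by
      rw [translation_translation (l := k + 2 * 3 ^ p) (q := p) (by push_cast; field_simp), ih]
    have e3 : inner ℂ (translation k p (translation 2 0 cantorIndicator))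
        (translation 2 0 cantorIndicator) = (coef p k : ℂ) := by
      rw [translation_translation (l := k + 2 * 3 ^ p) (q := p) (by push_cast; field_simp),
        ← translation_translation (k := 2) (p := 0) (k' := k) (p' := p)
        (by push_cast; field_simp; ring), inner_translation, ih]
    rw [e1, e2, e3, Complex.conj_ofReal, ← mul_assoc, coef_succ]
    push_cast
    rw [div_mul_div_comm, hc]
    ring

/-! ### The translates of the Cantor set span `L²` -/

/-- If a vector has inner products of constant modulus with a bounded orthogonal sequence, then
these inner products vanish. -/
theorem eq_zero_of_orthogonal_of_norm_inner_eq {H : Type*} [NormedAddCommGroup H]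
    [InnerProductSpace ℂ H] (v : ℕ → H) (f : H) (r : ℝ)
    (hv : Pairwise fun i j => inner ℂ (v i) (v j) = 0) (hv1 : ∀ i, ‖v i‖ ≤ 1)
    (hr : ∀ i, ‖inner ℂ (v i) f‖ = r) : r = 0 := by
  by_contra h0
  have hr0 : 0 < r := lt_of_le_of_ne (by rw [← hr 0]; positivity) (Ne.symm h0)
  have hne : ∀ i, v i ≠ 0 := fun i hi => h0 (by rw [← hr i, hi]; simp)
  have ho : Orthonormal ℂ fun i => ((‖v i‖⁻¹ : ℝ) : ℂ) • v i := by
    refine ⟨fun i => ?_, fun i j hij => ?_⟩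
    · rw [norm_smul, Complex.norm_real, norm_inv, norm_norm,
        inv_mul_cancel₀ (norm_ne_zero_iff.2 (hne i))]
    · change inner ℂ (((‖v i‖⁻¹ : ℝ) : ℂ) • v i) (((‖v j‖⁻¹ : ℝ) : ℂ) • v j) = 0
      rw [inner_smul_left, inner_smul_right, hv hij]
      simp
  -- By Bessel the squared coefficients tend to 0, yet each is at least r², since normalising a
  -- vector of norm at most 1 can only enlarge its coefficient.
  have ht := (ho.inner_products_summable f).tendsto_atTop_zero
  have : r ^ 2 ≤ 0 := by
    refine ge_of_tendsto ht (Eventually.of_forall fun i => ?_)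
    rw [inner_smul_left, norm_mul, hr, Complex.conj_ofReal, Complex.norm_real, norm_inv, norm_norm]
    have h1 : 1 ≤ ‖v i‖⁻¹ := (one_le_inv₀ (norm_pos_iff.2 (hne i))).2 (hv1 i)
    gcongr
    nlinarith
  nlinarith

/-- The scaled copy `t + C / 3 ^ n` of the Cantor set. -/
def cell (n : ℕ) (t : ℝ) : Set ℝ := {x | 3 ^ n * (x - t) ∈ cantorSet}

theorem measurableSet_cell (n : ℕ) (t : ℝ) : MeasurableSet (cell n t) :=
  isClosed_cantorSet.measurableSet.preimage (f := fun x : ℝ => 3 ^ n * (x - t)) (by fun_prop)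

theorem cell_subset_Icc (n : ℕ) (t : ℝ) : cell n t ⊆ Icc t (t + (3 ^ n)⁻¹) := by
  intro x hx
  obtain ⟨h0, h1⟩ := cantorSet_subset_unitInterval hx
  have h3 : (0 : ℝ) < 3 ^ n := by positivity
  constructor
  · have := nonneg_of_mul_nonneg_right h0 h3
    linarith
  · have : x - t ≤ (3 ^ n)⁻¹ := by
      rw [inv_eq_one_div, le_div_iff₀ h3]
      linarith
    linarith

theorem cell_eq_union (n : ℕ) (t : ℝ) :
    cell n t = cell (n + 1) t ∪ cell (n + 1) (t + 2 / 3 ^ (n + 1)) := by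
  ext x
  simp only [cell, mem_union, mem_ofPred_eq]
  rw [mem_cantorSet_iff_three_mul]
  have e1 : 3 * (3 ^ n * (x - t)) = 3 ^ (n + 1) * (x - t) := by ring
  have e2 : 3 ^ (n + 1) * (x - t) - 2 = 3 ^ (n + 1) * (x - (t + 2 / 3 ^ (n + 1))) := by
    field_simp
    ring
  rw [e1, e2]

theorem disjoint_cell (n : ℕ) {t t' : ℝ} (h : t + 2 / 3 ^ n ≤ t') :
    Disjoint (cell n t) (cell n t') := by
  rw [disjoint_left]
  intro x hx hx'
  have h1 := (cell_subset_Icc n t hx).2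
  have h2 := (cell_subset_Icc n t' hx').1
  have h3 : (0 : ℝ) < (3 ^ n)⁻¹ := by positivity
  rw [div_eq_mul_inv] at h
  linarith

theorem fractalMeasure_cell_le (n : ℕ) (t : ℝ) : fractalMeasure (cell n t) ≤ 1 := by
  induction n with
  | zero =>
    have h := (IsometryEquiv.subRight t).measurePreserving_hausdorffMeasure cantorDim
    refine (Measure.restrict_apply_le _ _).trans ?_
    have e : cell 0 t = IsometryEquiv.subRight t ⁻¹' cantorSet := by
      ext x
      simp [cell]
    rw [e, h.measure_preimage isClosed_cantorSet.measurableSet.nullMeasurableSet]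
    exact hausdorffMeasure_cantorSet_le_one
  | succ n ih =>
    refine (measure_mono ?_).trans ih
    rw [cell_eq_union n]
    exact subset_union_left

theorem fractalMeasure_cell_ne_top (n : ℕ) (t : ℝ) : fractalMeasure (cell n t) ≠ ∞ :=
  ne_top_of_le_ne_top ENNReal.one_ne_top (fractalMeasure_cell_le n t)

/-- The indicator function of a cell. -/
noncomputable def cellIndicator (n : ℕ) (t : ℝ) : FractalL2 :=
  indicatorConstLp 2 (measurableSet_cell n t) (fractalMeasure_cell_ne_top n t) 1

theorem inner_cellIndicator (n : ℕ) (t : ℝ) (f : FractalL2) :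
    inner ℂ (cellIndicator n t) f = ∫ x in cell n t, f x ∂fractalMeasure :=
  L2.inner_indicatorConstLp_one _ _ f

theorem norm_cellIndicator_le (n : ℕ) (t : ℝ) : ‖cellIndicator n t‖ ≤ 1 := by
  rw [cellIndicator, norm_indicatorConstLp (by norm_num) (by norm_num), norm_one, one_mul]
  refine Real.rpow_le_one measureReal_nonneg ?_ (by norm_num)
  exact ENNReal.toReal_le_of_le_ofReal zero_le_one (by simpa using fractalMeasure_cell_le n t)

theorem inner_cellIndicator_eq_zero (n : ℕ) {t t' : ℝ} (h : Disjoint (cell n t) (cell n t')) :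
    inner ℂ (cellIndicator n t) (cellIndicator n t') = 0 := by
  rw [inner_cellIndicator]
  refine setIntegral_eq_zero_of_ae_eq_zero ?_
  filter_upwards [indicatorConstLp_coeFn (p := 2) (hs := measurableSet_cell n t')
    (hμs := fractalMeasure_cell_ne_top n t') (c := (1 : ℂ))] with x hx hxt
  rw [cellIndicator, hx, indicator_of_notMem (disjoint_left.1 h hxt)]

theorem integrableOn_cell (n : ℕ) (t : ℝ) (f : FractalL2) :
    IntegrableOn f (cell n t) fractalMeasure :=
  integrableOn_Lp_of_measure_ne_top f fact_one_le_two_ennreal.elim (fractalMeasure_cell_ne_top n t)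

theorem translation_cantorIndicator (k : ℤ) (p : ℕ) :
    translation k p cantorIndicator = cellIndicator 0 (k / 3 ^ p) := by
  refine Lp.ext ?_
  filter_upwards [coeFn_translation k p cantorIndicator,
    (measurePreserving_sub k p).quasiMeasurePreserving.ae_eq_comp coeFn_cantorIndicator,
    indicatorConstLp_coeFn (p := 2) (hs := measurableSet_cell 0 (k / 3 ^ p))
    (hμs := fractalMeasure_cell_ne_top 0 (k / 3 ^ p)) (c := (1 : ℂ))] with x h1 h2 h3
  simp only [Function.comp_apply] at h2
  rw [h1, h2, cellIndicator, h3]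
  have h : x ∈ cell 0 (k / 3 ^ p) ↔ x - k / 3 ^ p ∈ cantorSet := by simp [cell]
  by_cases hx : x - k / 3 ^ p ∈ cantorSet <;> simp [h, hx]

theorem setIntegral_cell (n : ℕ) (t : ℝ) (f : FractalL2) :
    ∫ x in cell n t, f x ∂fractalMeasure = ∫ x in cell (n + 1) t, f x ∂fractalMeasure +
      ∫ x in cell (n + 1) (t + 2 / 3 ^ (n + 1)), f x ∂fractalMeasure := by
  rw [cell_eq_union, setIntegral_union (disjoint_cell _ le_rfl) (measurableSet_cell _ _)
    (integrableOn_cell _ _ f) (integrableOn_cell _ _ f)]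

/-- A cell of level n is two cells of level n + 1 at distance 2 / 3^(n+1). If all triadic level n
integrals vanish, the level n + 1 integrals along the progression `t i` alternate in sign with
constant modulus. These cells are pairwise disjoint with indicators of norm at most 1, so the
modulus is 0. -/
theorem setIntegral_cell_eq_zero {f : FractalL2}
    (hf : ∀ (k : ℤ) (p : ℕ), inner ℂ (translation k p cantorIndicator) f = 0) (n : ℕ) (k : ℤ)
    (p : ℕ) : ∫ x in cell n (k / 3 ^ p), f x ∂fractalMeasure = 0 := by
  induction n generalizing k p with
  | zero => rw [← inner_cellIndicator, ← translation_cantorIndicator, hf]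
  | succ n ih =>
    set t : ℕ → ℝ := fun i => k / 3 ^ p + i * (2 / 3 ^ (n + 1)) with ht
    have htri : ∀ i, t i = ((k * 3 ^ (n + 1) + 2 * i * 3 ^ p : ℤ) : ℝ) / 3 ^ (p + (n + 1)) := by
      intro i
      simp only [ht]
      push_cast
      rw [pow_add (3 : ℝ) p (n + 1)]
      field_simp
    have hsucc : ∀ i, t (i + 1) = t i + 2 / 3 ^ (n + 1) := by
      intro i
      simp only [ht]
      push_cast
      ring
    have hneg : ∀ i, inner ℂ (cellIndicator (n + 1) (t (i + 1))) f =
        -inner ℂ (cellIndicator (n + 1) (t i)) f := by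
      intro i
      have h := setIntegral_cell n (t i) f
      rw [htri i, ih, ← htri i, ← hsucc, ← inner_cellIndicator, ← inner_cellIndicator] at h
      exact eq_neg_of_add_eq_zero_right h.symm
    have hnorm : ∀ i, ‖inner ℂ (cellIndicator (n + 1) (t i)) f‖ =
        ‖inner ℂ (cellIndicator (n + 1) (t 0)) f‖ := by
      intro i
      induction i with
      | zero => rfl
      | succ i ihi => rw [hneg, norm_neg, ihi]
    have hpos : (0 : ℝ) < 2 / 3 ^ (n + 1) := by positivity
    have hlt : ∀ i j, i < j → Disjoint (cell (n + 1) (t i)) (cell (n + 1) (t j)) := by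
      intro i j hij
      refine disjoint_cell _ ?_
      rw [← hsucc]
      simp only [ht]
      have : ((i + 1 : ℕ) : ℝ) ≤ j := by exact_mod_cast hij
      gcongr
    have := eq_zero_of_orthogonal_of_norm_inner_eq (fun i => cellIndicator (n + 1) (t i)) f _
      (fun i j hij => inner_cellIndicator_eq_zero _ (by
        rcases lt_or_gt_of_ne hij with h | h
        · exact hlt i j h
        · exact (hlt j i h).symm)) (fun i => norm_cellIndicator_le _ _) hnorm
    have h0 := norm_eq_zero.1 this
    rw [inner_cellIndicator] at h0
    simpa [ht] using h0

/-- When `d = 0` the threshold is a grid point of the cell's own scale, so the cell lies on one side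
of it up to an endpoint. Otherwise the cell is split into its two halves, which brings the scales
one step closer. -/
theorem setIntegral_cell_inter_Iio_eq_zero {f : FractalL2}
    (hf : ∀ (k : ℤ) (p : ℕ), inner ℂ (translation k p cantorIndicator) f = 0) (d n : ℕ) (k j : ℤ) :
    ∫ x in cell n (k / 3 ^ n) ∩ Iio ((j : ℝ) / 3 ^ (n + d)), f x ∂fractalMeasure = 0 := by
  induction d generalizing n k with
  | zero =>
    rw [add_zero]
    have h3 : (0 : ℝ) < 3 ^ n := by positivity
    rcases le_or_gt j k with h | h
    · have : cell n (k / 3 ^ n) ∩ Iio ((j : ℝ) / 3 ^ n) = ∅ := by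
        refine eq_empty_of_forall_notMem fun x hx => ?_
        have h1 := (cell_subset_Icc _ _ hx.1).1
        have h2 : x < (j : ℝ) / 3 ^ n := hx.2
        have h4 : (j : ℝ) / 3 ^ n ≤ k / 3 ^ n := by
          have : (j : ℝ) ≤ k := by exact_mod_cast h
          gcongr
        linarith
      rw [this]
      simp
    · have hsub : cell n (k / 3 ^ n) ⊆ Iic ((j : ℝ) / 3 ^ n) := by
        intro x hx
        refine (cell_subset_Icc _ _ hx).2.trans ?_
        have : (k : ℝ) + 1 ≤ j := by exact_mod_cast h
        rw [inv_eq_one_div, ← add_div]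
        gcongr
      -- The right endpoint of the cell may equal the threshold; it is negligible because points are
      -- null.
      have hae : (cell n (k / 3 ^ n) ∩ Iio ((j : ℝ) / 3 ^ n) : Set ℝ) =ᵐ[fractalMeasure]
          (cell n (k / 3 ^ n) ∩ Iic ((j : ℝ) / 3 ^ n) : Set ℝ) :=
        (ae_eq_refl _).inter Iio_ae_eq_Iic
      rw [setIntegral_congr_set hae, inter_eq_self_of_subset_left hsub,
        setIntegral_cell_eq_zero hf]
  | succ d ih =>
    have e1 : (k : ℝ) / 3 ^ n = ((3 * k : ℤ) : ℝ) / 3 ^ (n + 1) := by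
      push_cast
      field_simp
      ring
    have e2 : (k : ℝ) / 3 ^ n + 2 / 3 ^ (n + 1) = ((3 * k + 2 : ℤ) : ℝ) / 3 ^ (n + 1) := by
      push_cast
      field_simp
      ring
    have e3 : n + (d + 1) = (n + 1) + d := by ring
    rw [cell_eq_union, union_inter_distrib_right, setIntegral_union
      ((disjoint_cell _ le_rfl).mono inter_subset_left inter_subset_left)
      ((measurableSet_cell _ _).inter measurableSet_Iio)
      ((integrableOn_cell _ _ f).mono_set inter_subset_left)
      ((integrableOn_cell _ _ f).mono_set inter_subset_left), e2, e1, e3, ih, ih, add_zero]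

/-- Truncating t at finer and finer triadic scales exhausts the half-line below t. Denominators
start at 3^n so that every generator is at least as fine as a level `n` cell. -/
theorem borel_eq_generateFrom_Iio_triadic (n : ℕ) :
    borel ℝ = MeasurableSpace.generateFrom
      (range fun a : ℤ × ℕ => Iio ((a.1 : ℝ) / 3 ^ (n + a.2))) := by
  refine le_antisymm ?_ (MeasurableSpace.generateFrom_le ?_)
  · rw [borel_eq_generateFrom_Iio]
    refine MeasurableSpace.generateFrom_le ?_
    rintro _ ⟨t, rfl⟩
    have : Iio t = ⋃ d : ℕ, Iio ((⌊3 ^ (n + d) * t⌋ : ℝ) / 3 ^ (n + d)) := by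
      ext x
      simp only [mem_Iio, mem_iUnion]
      constructor
      · intro hx
        obtain ⟨d, hd⟩ := exists_pow_lt_of_lt_one (sub_pos.2 hx) (by norm_num : (1 / 3 : ℝ) < 1)
        refine ⟨d, ?_⟩
        have h1 := Int.lt_floor_add_one (3 ^ (n + d) * t)
        have h3 : (0 : ℝ) < 3 ^ (n + d) := by positivity
        rw [lt_div_iff₀ h3]
        have h4 : (1 / 3 : ℝ) ^ d * 3 ^ (n + d) = 3 ^ n := by
          rw [pow_add, one_div, inv_pow]
          field_simp
        have h5 : (1 : ℝ) ≤ 3 ^ n := one_le_pow₀ (by norm_num)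
        nlinarith
      · rintro ⟨d, hd⟩
        refine hd.trans_le ?_
        rw [div_le_iff₀ (by positivity)]
        linarith [Int.floor_le (3 ^ (n + d) * t)]
    rw [this]
    exact MeasurableSet.iUnion fun d => MeasurableSpace.measurableSet_generateFrom ⟨(_, d), rfl⟩
  · rintro _ ⟨a, rfl⟩
    rw [← (inferInstance : BorelSpace ℝ).measurable_eq]
    exact measurableSet_Iio

/-- Half-lines with triadic endpoints form a π-system generating the Borel sets. Complements are
handled by the vanishing of the integral over the whole cell. -/
theorem ae_eq_zero_on_cell {f : FractalL2}
    (hf : ∀ (k : ℤ) (p : ℕ), inner ℂ (translation k p cantorIndicator) f = 0) (n : ℕ) (k : ℤ) :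
    f =ᵐ[fractalMeasure.restrict (cell n (k / 3 ^ n))] 0 := by
  have hint : Integrable f (fractalMeasure.restrict (cell n (k / 3 ^ n))) :=
    integrableOn_cell n _ f
  have hpi : IsPiSystem (range fun a : ℤ × ℕ => Iio ((a.1 : ℝ) / 3 ^ (n + a.2))) := by
    rintro _ ⟨a, rfl⟩ _ ⟨b, rfl⟩ -
    simp only [Iio_inter_Iio]
    rcases min_choice ((a.1 : ℝ) / 3 ^ (n + a.2)) ((b.1 : ℝ) / 3 ^ (n + b.2)) with h | h <;> rw [h]
    · exact ⟨a, rfl⟩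
    · exact ⟨b, rfl⟩
  have htot : ∫ x, f x ∂(fractalMeasure.restrict (cell n (k / 3 ^ n))) = 0 :=
    setIntegral_cell_eq_zero hf n k n
  refine hint.ae_eq_zero_of_forall_setIntegral_eq_zero fun s hs _ => ?_
  induction s, hs using MeasurableSpace.induction_on_inter
    ((inferInstance : BorelSpace ℝ).measurable_eq.trans (borel_eq_generateFrom_Iio_triadic n))
    hpi with
  | empty => simp
  | basic s hs =>
    obtain ⟨a, rfl⟩ := hs
    simp only
    rw [Measure.restrict_restrict measurableSet_Iio, inter_comm]
    exact setIntegral_cell_inter_Iio_eq_zero hf a.2 n k a.1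
  | compl s hs ih =>
    have := integral_add_compl hs hint
    rw [htot, ih (measure_lt_top_of_subset (subset_univ _) (by
      simpa using fractalMeasure_cell_ne_top n _)), zero_add] at this
    exact this
  | iUnion s hd hs ih =>
    rw [integral_iUnion hs hd hint.integrableOn]
    simp [fun i => ih i (measure_lt_top_of_subset (subset_univ _) (by
      simpa using fractalMeasure_cell_ne_top n _))]

/-- If x has finitely many digits 1, then 3^n x lies in ℤ + C for large n, so x lies in a level n
cell. -/
theorem ae_mem_iUnion_cell :
    ∀ᵐ x ∂fractalMeasure, x ∈ ⋃ a : ℕ × ℤ, cell a.1 (a.2 / 3 ^ a.1) := by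
  have hm : MeasurableSet (⋃ a : ℕ × ℤ, cell a.1 ((a.2 : ℝ) / 3 ^ a.1)) :=
    MeasurableSet.iUnion fun a => measurableSet_cell _ _
  change fractalMeasure _ᶜ = 0
  rw [fractalMeasure, Measure.restrict_apply (by exact hm.compl)]
  convert measure_empty (μ := (μH[cantorDim] : Measure ℝ))
  refine eq_empty_of_forall_notMem fun x hx => hx.1 ?_
  obtain ⟨n, hn⟩ := exists_int_add hx.2
  obtain ⟨k, c, hc, h⟩ := hn n le_rfl
  refine mem_iUnion.2 ⟨(n, k), ?_⟩
  have : 3 ^ n * (x - (k : ℝ) / 3 ^ n) = c := by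
    rw [mul_sub, h]
    field_simp
    ring
  simpa [cell, this] using hc

/-- The translates of the indicator function of the Cantor set are total in `L²(ℛ, ℋˢ)`. -/
theorem eq_zero_of_inner_translation_eq_zero {f : FractalL2}
    (hf : ∀ (k : ℤ) (p : ℕ), inner ℂ (translation k p cantorIndicator) f = 0) : f = 0 := by
  rw [Lp.eq_zero_iff_ae_eq_zero]
  have h : ∀ᵐ x ∂fractalMeasure, ∀ a : ℕ × ℤ, x ∈ cell a.1 (a.2 / 3 ^ a.1) → f x = 0 :=
    ae_all_iff.2 fun a => (ae_restrict_iff' (measurableSet_cell _ _)).1 (ae_eq_zero_on_cell hf _ _)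
  filter_upwards [h, ae_mem_iUnion_cell] with x hx hm
  obtain ⟨a, ha⟩ := mem_iUnion.1 hm
  exact hx a ha

theorem span_translation_closure :
    (Submodule.span ℂ (range fun a : ℤ × ℕ =>
      translation a.1 a.2 cantorIndicator)).topologicalClosure = ⊤ := by
  rw [Submodule.topologicalClosure_eq_top_iff, Submodule.eq_bot_iff]
  intro f hf
  refine eq_zero_of_inner_translation_eq_zero fun k p => ?_
  exact Submodule.inner_right_of_mem_orthogonal 
    (Submodule.subset_span (mem_range_self (k, p))) hf

/-! ### Unitaries between total families -/

theorem denseRange_linearCombination {ι H : Type*} [NormedAddCommGroup H] [InnerProductSpace ℂ H]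
    {v : ι → H} (hv : (Submodule.span ℂ (range v)).topologicalClosure = ⊤) :
    DenseRange (Finsupp.linearCombination ℂ v) := by
  rw [DenseRange, ← LinearMap.coe_range, Finsupp.range_linearCombination]
  exact Submodule.dense_iff_topologicalClosure_eq_top.2 hv

/-- Two total families with the same Gram matrix are related by a unitary. -/
theorem exists_linearIsometryEquiv_of_inner_eq {ι H K : Type*} [NormedAddCommGroup H]
    [InnerProductSpace ℂ H] [CompleteSpace H] [NormedAddCommGroup K] [InnerProductSpace ℂ K]
    [CompleteSpace K] (v : ι → H) (w : ι → K)
    (hv : (Submodule.span ℂ (range v)).topologicalClosure = ⊤)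
    (hw : (Submodule.span ℂ (range w)).topologicalClosure = ⊤)
    (h : ∀ i j, inner ℂ (v i) (v j) = inner ℂ (w i) (w j)) :
    ∃ F : H ≃ₗᵢ[ℂ] K, ∀ i, F (v i) = w i := by
  have hn : ∀ x : ι →₀ ℂ, ‖Finsupp.linearCombination ℂ w (LinearEquiv.refl ℂ (ι →₀ ℂ) x)‖ =
      ‖Finsupp.linearCombination ℂ v x‖ := by
    intro x
    rw [← sq_eq_sq₀ (norm_nonneg _) (norm_nonneg _), ← inner_self_eq_norm_sq (𝕜 := ℂ),
      ← inner_self_eq_norm_sq (𝕜 := ℂ), LinearEquiv.refl_apply,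
      Finsupp.linearCombination_apply, Finsupp.linearCombination_apply]
    congr 1
    simp only [Finsupp.sum_inner, Finsupp.inner_sum, inner_smul_left, inner_smul_right, h]
  refine ⟨(LinearEquiv.refl ℂ (ι →₀ ℂ)).extendOfIsometry (Finsupp.linearCombination ℂ v)
    (Finsupp.linearCombination ℂ w) (denseRange_linearCombination hv)
    (denseRange_linearCombination hw) hn, fun i => ?_⟩
  have := LinearEquiv.extendOfIsometry_eq (LinearEquiv.refl ℂ (ι →₀ ℂ))
    (Finsupp.linearCombination ℂ v) (Finsupp.linearCombination ℂ w)
    (denseRange_linearCombination hv) (denseRange_linearCombination hw) hn (Finsupp.single i 1)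
  simpa using this

theorem linearIsometry_ext {ι H K : Type*} [NormedAddCommGroup H] [InnerProductSpace ℂ H]
    [NormedAddCommGroup K] [InnerProductSpace ℂ K] {v : ι → H}
    (hv : (Submodule.span ℂ (range v)).topologicalClosure = ⊤) {A B : H →ₗᵢ[ℂ] K}
    (h : ∀ i, A (v i) = B (v i)) : A = B := by
  have : A.toContinuousLinearMap = B.toContinuousLinearMap := by
    refine ContinuousLinearMap.ext_on (Submodule.dense_iff_topologicalClosure_eq_top.2 hv) ?_
    rintro _ ⟨i, rfl⟩
    exact h i
  ext x
  exact DFunLike.congr_fun this x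

/-! ### Multiplication and transfer operators on the solenoid -/

theorem memLp_character_mul {m : Measure (Solenoid 3)} (k : ℤ) (p : ℕ) (f : Lp ℂ 2 m) :
    MemLp (fun z => character k p z * f z) 2 m :=
  (Lp.memLp f).of_le ((continuous_character k p).aestronglyMeasurable.mul
    (Lp.aestronglyMeasurable f)) (Eventually.of_forall fun z => by
      rw [norm_mul, norm_character, one_mul])

/-- Multiplication by a character. -/
noncomputable def characterMul (m : Measure (Solenoid 3)) (k : ℤ) (p : ℕ) :
    Lp ℂ 2 m →ₗᵢ[ℂ] Lp ℂ 2 m where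
  toFun f := (memLp_character_mul k p f).toLp _
  map_add' f g := by
    rw [← MemLp.toLp_add]
    refine MemLp.toLp_congr _ _ ?_
    filter_upwards [Lp.coeFn_add f g] with z h
    simp only [h, Pi.add_apply]
    ring
  map_smul' c f := by
    rw [RingHom.id_apply, ← MemLp.toLp_const_smul]
    refine MemLp.toLp_congr _ _ ?_
    filter_upwards [Lp.coeFn_smul c f] with z h
    simp only [h, Pi.smul_apply, smul_eq_mul]
    ring
  norm_map' f := by
    simp only [LinearMap.coe_mk, AddHom.coe_mk]
    rw [Lp.norm_toLp, Lp.norm_def]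
    congr 1
    refine eLpNorm_congr_norm_ae (Eventually.of_forall fun z => ?_)
    rw [norm_mul, norm_character, one_mul]

theorem coeFn_characterMul (m : Measure (Solenoid 3)) (k : ℤ) (p : ℕ) (f : Lp ℂ 2 m) :
    characterMul m k p f =ᵐ[m] fun z => character k p z * f z :=
  (memLp_character_mul k p f).coeFn_toLp

theorem continuous_lowPass : Continuous fun z : Solenoid 3 => lowPass (z.1 0) :=
  (continuous_const.add ((Solenoid.continuous_eval 0).pow 2)).div_const _

/-- The Fourier coefficients 1, 1/2, 1/2 of |m₀|² are the weights in the recursion of `coef`. -/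
theorem normSq_lowPass_eq (z : Solenoid 3) :
    ((‖lowPass (z.1 0)‖ ^ 2 : ℝ) : ℂ) =
      1 + 1 / 2 * character 2 0 z + 1 / 2 * character (-2) 0 z := by
  have h2 : (√2 : ℝ) * √2 = 2 := Real.mul_self_sqrt (by norm_num)
  have hc : ((√2 : ℝ) : ℂ) * ((√2 : ℝ) : ℂ) = 2 := by exact_mod_cast h2
  have hs : lowPass (z.1 0) = (1 + character 2 0 z) / (√2 : ℝ) := by
    rw [lowPass, character]
    norm_cast
  have hm : character 2 0 z * character (-2) 0 z = 1 := by
    rw [character, character, ← zpow_add₀ (z.ne_zero _)]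
    simp
  rw [Complex.ofReal_pow, ← Complex.mul_conj', hs, map_div₀, map_add, map_one, star_character,
    Complex.conj_ofReal, div_mul_div_comm, hc]
  linear_combination (1 / 2 : ℂ) * hm

/-- The measure `|m₀|² dm`. -/
noncomputable def lowPassMeasure (m : Measure (Solenoid 3)) : Measure (Solenoid 3) :=
  m.withDensity fun z => ((‖lowPass (z.1 0)‖₊ ^ 2 : ℝ≥0) : ℝ≥0∞)

theorem measurable_lowPass_sq :
    Measurable fun z : Solenoid 3 => ‖lowPass (z.1 0)‖₊ ^ 2 :=
  (continuous_lowPass.nnnorm.pow 2).measurable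

instance isFiniteMeasure_lowPassMeasure (m : Measure (Solenoid 3)) [IsFiniteMeasure m] :
    IsFiniteMeasure (lowPassMeasure m) := by
  refine isFiniteMeasure_withDensity (ne_of_lt ?_)
  obtain ⟨C, hC⟩ := isCompact_univ.bddAbove_image
    (continuous_lowPass.nnnorm.pow 2).continuousOn
  calc ∫⁻ z, ((‖lowPass (z.1 0)‖₊ ^ 2 : ℝ≥0) : ℝ≥0∞) ∂m ≤ ∫⁻ _, (C : ℝ≥0∞) ∂m :=
        lintegral_mono fun z => ENNReal.coe_le_coe.2 (hC ⟨z, trivial, rfl⟩)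
    _ < ∞ := by
        rw [lintegral_const]
        exact ENNReal.mul_lt_top ENNReal.coe_lt_top (measure_lt_top _ _)

/-- The shift maps `|m₀|² dm` to `m`. -/
theorem map_shift_lowPassMeasure {m : Measure (Solenoid 3)} [IsFiniteMeasure m]
    (hm : HasCantorCoefficients m) : (lowPassMeasure m).map Solenoid.shift = m := by
  have hmeas : Measurable (Solenoid.shift (N := 3)) := Solenoid.continuous_shift.measurable
  rw [hasCantorCoefficients_iff] at hm
  refine ext_of_integral_character fun k p => ?_
  rw [integral_map hmeas.aemeasurable (continuous_character k p).aestronglyMeasurable,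
    lowPassMeasure, integral_withDensity_eq_integral_smul measurable_lowPass_sq, hm]
  calc ∫ z, (‖lowPass (z.1 0)‖₊ ^ 2) • character k p z.shift ∂m
      = ∫ z, (character (3 * k) p z + 1 / 2 * character (3 * k + 2 * 3 ^ p) p z +
          1 / 2 * character (3 * k - 2 * 3 ^ p) p z) ∂m := by
        refine integral_congr_ae (Eventually.of_forall fun z => ?_)
        simp only
        rw [character_shift, NNReal.smul_def, Complex.real_smul]
        push_cast
        have h := normSq_lowPass_eq z
        push_cast at h
        have h1 := character_mul 2 (3 * k) 0 p z
        have h2 := character_mul (-2) (3 * k) 0 p z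
        rw [zero_add, show 2 * 3 ^ p + 3 * k * 3 ^ 0 = 3 * k + 2 * 3 ^ p by ring] at h1
        rw [zero_add, show -2 * 3 ^ p + 3 * k * 3 ^ 0 = 3 * k - 2 * 3 ^ p by ring] at h2
        rw [h, ← h1, ← h2]
        ring
    _ = coef p (3 * k) + 1 / 2 * coef p (3 * k + 2 * 3 ^ p) +
          1 / 2 * coef p (3 * k - 2 * 3 ^ p) := by
        have hi := integrable_character m
        have hi' : Integrable (fun z => character (3 * k) p z +
            1 / 2 * character (3 * k + 2 * 3 ^ p) p z) m :=
          (hi _ _).add ((hi _ _).const_mul _)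
        rw [integral_add hi' ((hi _ _).const_mul _),
          integral_add (hi _ _) ((hi _ _).const_mul _), integral_const_mul, integral_const_mul,
          hm, hm, hm]
    _ = coef p k := by
        -- The sum is the recursion for `coef (p + 1) (3 * k)`, and deleting the last digit 0 turns
        -- this into `coef p k`.
        rw [← coef_three_mul p k, coef_succ]
        push_cast
        ring

/-- It is |m₀|² dm that the shift carries to m, so almost everywhere statements are pulled back only
off the zeros of m₀. This suffices, because m₀·(f∘S) vanishes at those zeros whatever f is. -/
theorem ae_shift {m : Measure (Solenoid 3)} [IsFiniteMeasure m] (hm : HasCantorCoefficients m)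
    {P : Solenoid 3 → Prop} (hP : ∀ᵐ z ∂m, P z) :
    ∀ᵐ z ∂m, lowPass (z.1 0) ≠ 0 → P z.shift := by
  rw [← map_shift_lowPassMeasure hm] at hP
  have h := ae_of_ae_map Solenoid.continuous_shift.measurable.aemeasurable hP
  rw [lowPassMeasure, ae_withDensity_iff measurable_lowPass_sq.coe_nnreal_ennreal] at h
  filter_upwards [h] with z hz h0
  exact hz (by simpa using h0)

theorem eLpNorm_lowPass_mul_shift {m : Measure (Solenoid 3)} [IsFiniteMeasure m]
    (hm : HasCantorCoefficients m) (f : Lp ℂ 2 m) :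
    eLpNorm (fun z => lowPass (z.1 0) * f z.shift) 2 m = eLpNorm f 2 m := by
  have hf : Measurable fun z => ‖f z‖ₑ ^ (2 : ℝ) :=
    (Lp.stronglyMeasurable f).measurable.enorm.pow_const _
  have hfs : Measurable fun z : Solenoid 3 => ‖f z.shift‖ₑ ^ (2 : ℝ) :=
    hf.comp Solenoid.continuous_shift.measurable
  rw [eLpNorm_eq_lintegral_rpow_enorm_toReal (by norm_num) (by norm_num),
    eLpNorm_eq_lintegral_rpow_enorm_toReal (by norm_num) (by norm_num)]
  congr 1
  simp only [ENNReal.toReal_ofNat]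
  refine Eq.trans ?_ (congrArg (fun μ : Measure (Solenoid 3) => ∫⁻ z, ‖f z‖ₑ ^ (2 : ℝ) ∂μ)
    (map_shift_lowPassMeasure hm))
  rw [lintegral_map hf Solenoid.continuous_shift.measurable, lowPassMeasure,
    lintegral_withDensity_eq_lintegral_mul _ measurable_lowPass_sq.coe_nnreal_ennreal
      hfs]
  refine lintegral_congr fun z => ?_
  simp only [Pi.mul_apply]
  rw [enorm_mul, ENNReal.mul_rpow_of_nonneg _ _ (by norm_num)]
  congr 1
  simp [enorm_eq_nnnorm]

theorem memLp_lowPass_mul_shift {m : Measure (Solenoid 3)} [IsFiniteMeasure m]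
    (hm : HasCantorCoefficients m) (f : Lp ℂ 2 m) :
    MemLp (fun z => lowPass (z.1 0) * f z.shift) 2 m := by
  refine ⟨?_, ?_⟩
  · exact continuous_lowPass.aestronglyMeasurable.mul
      ((Lp.stronglyMeasurable f).comp_measurable
        Solenoid.continuous_shift.measurable).aestronglyMeasurable
  · rw [eLpNorm_lowPass_mul_shift hm]
    exact Lp.eLpNorm_lt_top f

/-- The operator `f ↦ m₀ · (f ∘ S)`. -/
noncomputable def lowPassShift {m : Measure (Solenoid 3)} [IsFiniteMeasure m]
    (hm : HasCantorCoefficients m) : Lp ℂ 2 m →ₗᵢ[ℂ] Lp ℂ 2 m where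
  toFun f := (memLp_lowPass_mul_shift hm f).toLp _
  map_add' f g := by
    rw [← MemLp.toLp_add]
    refine MemLp.toLp_congr _ _ ?_
    filter_upwards [ae_shift hm (Lp.coeFn_add f g)] with z h
    by_cases h0 : lowPass (z.1 0) = 0
    · simp [h0]
    · simp only [h h0, Pi.add_apply]
      ring
  map_smul' c f := by
    rw [RingHom.id_apply, ← MemLp.toLp_const_smul]
    refine MemLp.toLp_congr _ _ ?_
    filter_upwards [ae_shift hm (Lp.coeFn_smul c f)] with z h
    by_cases h0 : lowPass (z.1 0) = 0
    · simp [h0]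
    · simp only [h h0, Pi.smul_apply, smul_eq_mul]
      ring
  norm_map' f := by
    simp only [LinearMap.coe_mk, AddHom.coe_mk]
    rw [Lp.norm_toLp, Lp.norm_def, eLpNorm_lowPass_mul_shift hm]

theorem coeFn_lowPassShift {m : Measure (Solenoid 3)} [IsFiniteMeasure m]
    (hm : HasCantorCoefficients m) (f : Lp ℂ 2 m) :
    lowPassShift hm f =ᵐ[m] fun z => lowPass (z.1 0) * f z.shift :=
  (memLp_lowPass_mul_shift hm f).coeFn_toLp

theorem characterMul_characterL2 (m : Measure (Solenoid 3)) [IsFiniteMeasure m] (k : ℤ) (p : ℕ)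
    (a : ℤ × ℕ) : characterMul m k p (characterL2 m a) =
      characterL2 m (k * 3 ^ a.2 + a.1 * 3 ^ p, p + a.2) := by
  refine Lp.ext ?_
  filter_upwards [coeFn_characterMul m k p (characterL2 m a), coeFn_characterL2 m a,
    coeFn_characterL2 m (k * 3 ^ a.2 + a.1 * 3 ^ p, p + a.2)] with z h1 h2 h3
  rw [h1, h2, h3, character_mul]

theorem lowPassShift_characterL2 {m : Measure (Solenoid 3)} [IsFiniteMeasure m]
    (hm : HasCantorCoefficients m) (a : ℤ × ℕ) : lowPassShift hm (characterL2 m a) =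
      ((1 / √2 : ℝ) : ℂ) • (characterL2 m (3 * a.1, a.2) +
        characterL2 m (3 * a.1 + 2 * 3 ^ a.2, a.2)) := by
  refine Lp.ext ?_
  filter_upwards [coeFn_lowPassShift hm (characterL2 m a), ae_shift hm (coeFn_characterL2 m a),
    Lp.coeFn_smul ((1 / √2 : ℝ) : ℂ) (characterL2 m (3 * a.1, a.2) +
        characterL2 m (3 * a.1 + 2 * 3 ^ a.2, a.2)),
    Lp.coeFn_add (characterL2 m (3 * a.1, a.2)) (characterL2 m (3 * a.1 + 2 * 3 ^ a.2, a.2)),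
    coeFn_characterL2 m (3 * a.1, a.2), coeFn_characterL2 m (3 * a.1 + 2 * 3 ^ a.2, a.2)]
    with z h1 h2 h3 h4 h5 h6
  have h7 : lowPass (z.1 0) * characterL2 m a z.shift =
      lowPass (z.1 0) * character a.1 a.2 z.shift := by
    by_cases h0 : lowPass (z.1 0) = 0
    · simp [h0]
    · rw [h2 h0]
  have h8 := character_mul 2 (3 * a.1) 0 a.2 z
  rw [zero_add, show 2 * 3 ^ a.2 + 3 * a.1 * 3 ^ 0 = 3 * a.1 + 2 * 3 ^ a.2 by ring] at h8
  have hs : lowPass (z.1 0) = (1 + character 2 0 z) / (√2 : ℝ) := by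
    rw [lowPass, character]
    norm_cast
  rw [h1, h7, h3, Pi.smul_apply, h4, Pi.add_apply, h5, h6, character_shift, ← h8, smul_eq_mul, hs]
  push_cast
  ring

/-! ### The Fourier transform and its intertwining relations -/

theorem inner_translation_translation (a b : ℤ × ℕ) :
    inner ℂ (translation a.1 a.2 cantorIndicator) (translation b.1 b.2 cantorIndicator) =
      (coef (b.2 + a.2) (b.1 * 3 ^ a.2 - a.1 * 3 ^ b.2) : ℂ) := by
  rw [← inner_conj_symm, ← translation_translation (k := a.1) (p := a.2)
    (k' := b.1 * 3 ^ a.2 - a.1 * 3 ^ b.2) (p' := b.2 + a.2) (l := b.1) (q := b.2)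
    (by push_cast; rw [pow_add]; field_simp; ring), inner_translation,
    inner_translation_cantorIndicator, Complex.conj_ofReal]

theorem exists_fourierTransform {m : Measure (Solenoid 3)} [IsProbabilityMeasure m]
    (hm : HasCantorCoefficients m) :
    ∃ F : FractalL2 ≃ₗᵢ[ℂ] Lp ℂ 2 m,
      ∀ a : ℤ × ℕ, F (translation a.1 a.2 cantorIndicator) = characterL2 m a := by
  refine exists_linearIsometryEquiv_of_inner_eq _ _ span_translation_closure
    (span_characterL2_closure m) fun a b => ?_
  rw [inner_translation_translation, inner_characterL2, hasCantorCoefficients_iff.1 hm]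

theorem fourierTransform_translation {m : Measure (Solenoid 3)} [IsProbabilityMeasure m]
    (F : FractalL2 ≃ₗᵢ[ℂ] Lp ℂ 2 m)
    (hF : ∀ a : ℤ × ℕ, F (translation a.1 a.2 cantorIndicator) = characterL2 m a)
    (k : ℤ) (p : ℕ) (f : Lp ℂ 2 m) :
    F (translation k p (F.symm f)) = characterMul m k p f := by
  have h : F.toLinearIsometry.comp ((translationIsometry k p).comp F.symm.toLinearIsometry) =
      characterMul m k p := by
    refine linearIsometry_ext (span_characterL2_closure m) fun a => ?_
    change F (translationIsometry k p (F.symm (characterL2 m a))) = _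
    rw [← hF a, F.symm_apply_apply, translationIsometry_apply,
      translation_translation (l := k * 3 ^ a.2 + a.1 * 3 ^ p) (q := p + a.2)
        (by push_cast; rw [pow_add]; field_simp), hF a, characterMul_characterL2]
    exact hF (k * 3 ^ a.2 + a.1 * 3 ^ p, p + a.2)
  rw [← h]
  simp [translationIsometry_apply]

theorem fourierTransform_dilation {m : Measure (Solenoid 3)} [IsProbabilityMeasure m]
    (hm : HasCantorCoefficients m) (F : FractalL2 ≃ₗᵢ[ℂ] Lp ℂ 2 m)
    (hF : ∀ a : ℤ × ℕ, F (translation a.1 a.2 cantorIndicator) = characterL2 m a)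
    (f : Lp ℂ 2 m) : F (dilation (F.symm f)) = lowPassShift hm f := by
  have h : F.toLinearIsometry.comp (dilationIsometry.comp F.symm.toLinearIsometry) =
      lowPassShift hm := by
    refine linearIsometry_ext (span_characterL2_closure m) fun a => ?_
    change F (dilationIsometry (F.symm (characterL2 m a))) = _
    rw [← hF a, F.symm_apply_apply, dilationIsometry_apply,
      dilation_translation (l := 3 * a.1) (q := a.2) (by push_cast; ring),
      dilation_cantorIndicator, translation_smul, translation_add,
      translation_translation (l := 3 * a.1 + 2 * 3 ^ a.2) (q := a.2)
        (by push_cast; field_simp), hF a, lowPassShift_characterL2, map_smul, map_add,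
      hF (3 * a.1, a.2), hF (3 * a.1 + 2 * 3 ^ a.2, a.2)]
  rw [← h]
  simp [dilationIsometry_apply]

theorem characterL2_zero_ae_eq_one (m : Measure (Solenoid 3)) [IsFiniteMeasure m] :
    characterL2 m (0, 0) =ᵐ[m] fun _ => 1 :=
  (coeFn_characterL2 m (0, 0)).trans (Eventually.of_forall fun z => character_zero 0 z)

end FractalFourier

theorem corollary4p2p3 :
    (∃! m : Measure (FractalFourier.Solenoid 3),
      IsProbabilityMeasure m ∧ FractalFourier.HasCantorCoefficients m) ∧
    ∀ m : Measure (FractalFourier.Solenoid 3),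
      IsProbabilityMeasure m → FractalFourier.HasCantorCoefficients m →
      ∃! F : FractalFourier.FractalL2 ≃ₗᵢ[ℂ] Lp ℂ 2 m,
        (∀ (k : ℤ) (p : ℕ) (f : Lp ℂ 2 m),
          F (FractalFourier.translation k p (F.symm f))
            =ᵐ[m] fun z => FractalFourier.character k p z * f z) ∧
        (∀ f : Lp ℂ 2 m,
          F (FractalFourier.dilation (F.symm f))
            =ᵐ[m] fun z => FractalFourier.lowPass (z.1 0) * f z.shift) ∧
        F FractalFourier.cantorIndicator =ᵐ[m] fun _ => 1 := by
  open FractalFourier in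
  refine ⟨existsUnique_hasCantorCoefficients, fun m _ hm => ?_⟩
  obtain ⟨F, hF⟩ := exists_fourierTransform hm
  refine ⟨F, ⟨fun k p f => ?_, fun f => ?_, ?_⟩, fun G ⟨hG, _, hG1⟩ => ?_⟩
  · rw [fourierTransform_translation F hF]
    exact coeFn_characterMul m k p f
  · rw [fourierTransform_dilation hm F hF]
    exact coeFn_lowPassShift hm f
  · have := hF (0, 0)
    rw [translation_zero] at this
    rw [this]
    exact characterL2_zero_ae_eq_one m
  · have h : G.toLinearIsometry = F.toLinearIsometry := by
      refine linearIsometry_ext span_translation_closure fun a => ?_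
      rw [LinearIsometryEquiv.coe_toLinearIsometry, LinearIsometryEquiv.coe_toLinearIsometry, hF]
      refine Lp.ext ?_
      -- Translation covariance applied to G χ_C = 1 gives G T_λ χ_C = χ_λ, which determines G on a
      -- total family.
      have h1 := hG a.1 a.2 (G cantorIndicator)
      rw [G.symm_apply_apply] at h1
      filter_upwards [h1, hG1, coeFn_characterL2 m a] with z h2 h3 h4
      rw [h2, h3, h4, mul_one]
    ext1 x
    exact DFunLike.congr_fun h x
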